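/- Let $\ell>0$, let $q:\mathbb{R}\to\mathbb{R}$ be periodic with period $\ell$ and integrable over a period, and let $\alpha\in[0,\pi)$. Consider Hill's equation $$-y''+q(x)\,y=z\,y,\qquad 0\le x<\infty, \tag{1}$$ where a solution is a differentiable function $y$ whose derivative $y'$ is locally absolutely continuous and which satisfies the equation almost everywhere. For $z\in\mathbb{C}$ let $\theta(\cdot,z),\varphi(\cdot,z)$ be the solutions of (1) with $$\theta(0)=\cos\alpha,\quad \theta'(0)=\sin\alpha,\qquad \varphi(0)=-\sin\alpha,\quad \varphi'(0)=\cos\alpha .$$ Then for every $z$ with $\operatorname{Im}z\neq0$ there is a unique $m(z)\in\mathbb{C}$ with $\theta(\cdot,z)+m(z)\varphi(\cdot,z)\in L^2(0,\infty)$ (the Titchmarsh–Weyl $m$-function). Call $\lambda\in\mathbb{R}$ a periodic (semi-periodic) eigenvalue if (1) with $z=\lambda$ has a nontrivial solution with $y(\ell)=y(0)$, $y'(\ell)=y'(0)$ (respectively $y(\ell)=-y(0)$, $y'(\ell)=-y'(0)$). Counted with multiplicity, the periodic eigenvalues $\lambda_n$ and the semi-periodic eigenvalues $\mu_n$ occur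 in the order $\lambda_0<\mu_0\le\mu_1<\lambda_1\le\lambda_2<\mu_2\le\mu_3<\lambda_3\le\cdots$. The stability intervals are the open intervals $(\lambda_0,\mu_0),(\mu_1,\lambda_1),(\lambda_2,\mu_2),(\mu_3,\lambda_3),\dots$, that is, the open intervals bounded by a periodic and a semi-periodic eigenvalue that contain no periodic or semi-periodic eigenvalue. Let $\lambda$ be in a stability interval, and let $u,v$ be the real solutions of (1) for $z=\lambda$ with $u(0)=1$, $u'(0)=0$, $v(0)=0$, $v'(0)=1$. Then $4-[u(\ell)+v'(\ell)]^2>0$, the denominator below is nonzero, the limit $$f(\lambda)=\frac1\pi\lim_{\varepsilon\to0^+}\operatorname{Im}m(\lambda+i\varepsilon)$$ (the spectral density at $\lambda$) exists, and $$f(\lambda)=\left|\frac{\sqrt{4-[u(\ell)+v'(\ell)]^2}}{2\pi\left[u'(\ell)\sin^2\alpha+(u(\ell)-v'(\ell))\cos\alpha\sin\alpha-v(\ell)\cos^2\alpha\right]}\right| .$$ -/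

import Mathlib

open Set Filter Topology MeasureTheory

namespace Hill

/-- `y`, with derivative `dy`, solves `-y'' + q y = z y` on `[0, ∞)`: `y` is differentiable with
derivative `dy`, and `dy` is a primitive of `(q - z) y`, that is, `dy` is locally absolutely
continuous and the equation holds almost everywhere (everywhere if `q` is continuous). -/
structure IsSolution {𝕜 : Type*} [RCLike 𝕜] (q : ℝ → ℝ) (z : 𝕜) (y dy : ℝ → 𝕜) : Prop where
  hasDeriv : ∀ x : ℝ, 0 ≤ x → HasDerivWithinAt y (dy x) (Ici 0) x
  equation : ∀ x : ℝ, 0 ≤ x → dy x = dy 0 + ∫ t in (0 : ℝ)..x, (q t • y t - z * y t)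

/-- The solution of the initial value problem `y(0) = a`, `y'(0) = b`. -/
structure IsSolutionIVP {𝕜 : Type*} [RCLike 𝕜] (q : ℝ → ℝ) (z a b : 𝕜) (y dy : ℝ → 𝕜) : Prop
    extends IsSolution q z y dy where
  init : y 0 = a
  init_deriv : dy 0 = b

/-- `lam` is an eigenvalue of the regular problem `-y'' + q y = lam y` on `[0, ℓ]` with boundary
conditions `y(0) = s y(ℓ)`, `y'(0) = s y'(ℓ)`. -/
def IsEigenvalue (q : ℝ → ℝ) (ℓ s lam : ℝ) : Prop :=
  ∃ y dy : ℝ → ℝ, IsSolution q lam y dy ∧ (∃ x ∈ Icc 0 ℓ, y x ≠ 0) ∧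
    y 0 = s * y ℓ ∧ dy 0 = s * dy ℓ

/-- Eigenvalues of the periodic problem. -/
def IsPeriodicEigenvalue (q : ℝ → ℝ) (ℓ lam : ℝ) : Prop := IsEigenvalue q ℓ 1 lam

/-- Eigenvalues of the semi-periodic (antiperiodic) problem. -/
def IsSemiperiodicEigenvalue (q : ℝ → ℝ) (ℓ lam : ℝ) : Prop := IsEigenvalue q ℓ (-1) lam

/-- `(a, b)` is a stability interval. The periodic eigenvalues `λₙ` and the semi-periodic
eigenvalues `μₙ` occur in the order `λ₀ < μ₀ ≤ μ₁ < λ₁ ≤ λ₂ < μ₂ ≤ μ₃ < λ₃ ≤ λ₄ < ...`, and the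
stability intervals are `(λ₀, μ₀), (μ₁, λ₁), (λ₂, μ₂), (μ₃, λ₃), ...`: the open intervals between a
periodic and a semi-periodic eigenvalue that are adjacent in this order. -/
def IsStabilityInterval (q : ℝ → ℝ) (ℓ a b : ℝ) : Prop :=
  a < b ∧
  ((IsPeriodicEigenvalue q ℓ a ∧ IsSemiperiodicEigenvalue q ℓ b) ∨
    (IsSemiperiodicEigenvalue q ℓ a ∧ IsPeriodicEigenvalue q ℓ b)) ∧
  ∀ x ∈ Ioo a b, ¬ IsPeriodicEigenvalue q ℓ x ∧ ¬ IsSemiperiodicEigenvalue q ℓ x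

/-- `m` is a Titchmarsh-Weyl coefficient at `z`: `θ(·, z) + m φ(·, z)` lies in `L²(0, ∞)`, where
`θ(0) = cos α`, `θ'(0) = sin α`, `φ(0) = -sin α`, `φ'(0) = cos α`. -/
def IsTitchmarshWeyl (q : ℝ → ℝ) (α : ℝ) (z m : ℂ) : Prop :=
  ∃ θ dθ φ dφ : ℝ → ℂ,
    IsSolutionIVP q z (Real.cos α : ℂ) (Real.sin α : ℂ) θ dθ ∧
    IsSolutionIVP q z (-(Real.sin α : ℂ)) (Real.cos α : ℂ) φ dφ ∧
    MemLp (fun x => θ x + m * φ x) 2 (volume.restrict (Ioi 0))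

open Classical in
/-- The Titchmarsh-Weyl `m`-function (with value `0` at points where no coefficient exists). -/
noncomputable def titchmarshWeylM (q : ℝ → ℝ) (α : ℝ) (z : ℂ) : ℂ :=
  if h : ∃ m : ℂ, IsTitchmarshWeyl q α z m then h.choose else 0

/-- `f` is the value at `lam` of the spectral density function
`(1/π) lim_{ε → 0+} Im m(lam + iε)`; the existence of the limit is part of the claim. -/
def IsSpectralDensityAt (q : ℝ → ℝ) (α lam f : ℝ) : Prop :=
  Tendsto (fun ε : ℝ => 1 / Real.pi * (titchmarshWeylM q α (lam + ε * Complex.I)).im)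
    (𝓝[>] 0) (𝓝 f)

end Hill

/-!
For `Im z ≠ 0` Green's identity over one period shows that no Floquet multiplier lies on the unit
circle, so exactly one Floquet solution decays; it is the Weyl solution `ψ = θ + m φ`. Hence the
vector `(1, m(z))` is an eigenvector of the monodromy matrix written in the basis `θ, φ`, and `m(z)`
is a root of a quadratic equation whose coefficients are the entries of that matrix. These entries
are continuous in `z` and the discriminant of the quadratic is `(tr)² - 4`, which is negative on a
stability interval. As `Im m(z)` has the sign of `Im z`, letting `z → λ + i0` selects the root in
the upper half-plane.
-/

namespace Hill

section AbsolutelyContinuous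

variable {E F : Type*} [NormedAddCommGroup E] [NormedAddCommGroup F] {a b : ℝ}

theorem absolutelyContinuousOnInterval_comp_of_lipschitzOnWith {h : E → F} {f : ℝ → E} {K : NNReal}
    {s : Set E} (hh : LipschitzOnWith K h s) (hf : AbsolutelyContinuousOnInterval f a b)
    (hfs : MapsTo f (uIcc a b) s) : AbsolutelyContinuousOnInterval (fun x => h (f x)) a b := by
  rw [absolutelyContinuousOnInterval_iff] at hf ⊢
  intro ε hε
  obtain ⟨δ, hδ, hfδ⟩ := hf (ε / (K + 1)) (by positivity)
  refine ⟨δ, hδ, fun I hI hlen => ?_⟩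
  calc ∑ i ∈ Finset.range I.1, dist (h (f (I.2 i).1)) (h (f (I.2 i).2))
      ≤ ∑ i ∈ Finset.range I.1, (K + 1) * dist (f (I.2 i).1) (f (I.2 i).2) := by
        refine Finset.sum_le_sum fun i hi => ?_
        refine (hh.dist_le_mul _ (hfs (hI.1 i hi).1) _ (hfs (hI.1 i hi).2)).trans ?_
        gcongr
        exact le_add_of_nonneg_right zero_le_one
    _ = (K + 1) * ∑ i ∈ Finset.range I.1, dist (f (I.2 i).1) (f (I.2 i).2) :=
        (Finset.mul_sum _ _ _).symm
    _ < (K + 1) * (ε / (K + 1)) := by gcongr; exact hfδ I hI hlen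
    _ = ε := by field

variable [NormedSpace ℝ E]

theorem absolutelyContinuousOnInterval_intervalIntegral {f : ℝ → E}
    (hf : IntervalIntegrable f volume a b) :
    AbsolutelyContinuousOnInterval (fun x => ∫ t in a..x, f t) a b := by
  have hnorm := hf.norm.absolutelyContinuousOnInterval_intervalIntegral left_mem_uIcc
  rw [absolutelyContinuousOnInterval_iff] at hnorm ⊢
  intro ε hε
  obtain ⟨δ, hδ, hsum⟩ := hnorm ε hε
  refine ⟨δ, hδ, fun I hI hlen => (Finset.sum_le_sum fun i hi => ?_).trans_lt (hsum I hI hlen)⟩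
  have hint {x : ℝ} (hx : x ∈ uIcc a b) : IntervalIntegrable f volume a x :=
    hf.mono_set (uIcc_subset_uIcc left_mem_uIcc hx)
  obtain ⟨h₁, h₂⟩ := hI.1 i hi
  rw [dist_eq_norm, dist_eq_norm, intervalIntegral.integral_interval_sub_left (hint h₁) (hint h₂),
    intervalIntegral.integral_interval_sub_left (hint h₁).norm (hint h₂).norm, Real.norm_eq_abs]
  exact intervalIntegral.norm_integral_le_abs_integral_norm

theorem continuousOn_of_eq_add_integral {f F : ℝ → E} (hf : IntervalIntegrable f volume a b)
    (hF : ∀ x ∈ uIcc a b, F x = F a + ∫ t in a..x, f t) : ContinuousOn F (uIcc a b) :=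
  (continuousOn_const.add (absolutelyContinuousOnInterval_intervalIntegral hf).continuousOn).congr
    hF

variable [CompleteSpace E]

theorem integral_eq_sub_of_absolutelyContinuousOnInterval {f F : ℝ → E}
    (hf : IntervalIntegrable f volume a b) (hF : AbsolutelyContinuousOnInterval F a b)
    (hderiv : ∀ᵐ x, x ∈ uIcc a b → HasDerivAt F (f x) x) : ∫ x in a..b, f x = F b - F a := by
  obtain ⟨C, hC⟩ := (hF.fun_sub
    (absolutelyContinuousOnInterval_intervalIntegral hf)).const_of_ae_hasDerivAt_zero (by
      filter_upwards [hderiv, hf.ae_hasDerivAt_integral] with x hFx hfx hx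
      simpa using (hFx hx).fun_sub (hfx hx a left_mem_uIcc))
  have ha : F a = C := by simpa using hC a left_mem_uIcc
  rw [ha, ← hC b right_mem_uIcc, sub_sub_cancel]

end AbsolutelyContinuous

section Primitive

variable {a b : ℝ}

theorem mul_sub_mul_eq_integral {𝕜 : Type*} [RCLike 𝕜] {f g F G : ℝ → 𝕜}
    (hf : IntervalIntegrable f volume a b) (hg : IntervalIntegrable g volume a b)
    (hF : ∀ x ∈ uIcc a b, F x = F a + ∫ t in a..x, f t)
    (hG : ∀ x ∈ uIcc a b, G x = G a + ∫ t in a..x, g t) :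
    F b * G b - F a * G a = ∫ x in a..b, (f x * G x + F x * g x) := by
  set F' : ℝ → 𝕜 := fun x => F a + ∫ t in a..x, f t with hF'
  set G' : ℝ → 𝕜 := fun x => G a + ∫ t in a..x, g t with hG'
  have hac {k : ℝ → 𝕜} (c : 𝕜) (hk : IntervalIntegrable k volume a b) :
      AbsolutelyContinuousOnInterval (fun x => c + ∫ t in a..x, k t) a b :=
    contDiff_const.contDiffOn.absolutelyContinuousOnInterval.fun_add
      (absolutelyContinuousOnInterval_intervalIntegral hk)
  have hF'ac := hac (F a) hf
  have hG'ac := hac (G a) hg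
  have hint : IntervalIntegrable (fun x => f x * G' x + F' x * g x) volume a b :=
    (hf.mul_continuousOn hG'ac.continuousOn).add (hg.continuousOn_mul hF'ac.continuousOn)
  have key := integral_eq_sub_of_absolutelyContinuousOnInterval hint (hF'ac.fun_smul hG'ac) (by
    filter_upwards [hf.ae_hasDerivAt_integral, hg.ae_hasDerivAt_integral] with x hfx hgx hx
    exact ((hfx hx a left_mem_uIcc).const_add (F a)).mul
      ((hgx hx a left_mem_uIcc).const_add (G a)))
  rw [hF b right_mem_uIcc, hG b right_mem_uIcc]
  simp only [smul_eq_mul, hF', hG', intervalIntegral.integral_same, add_zero] at key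
  rw [← key]
  refine intervalIntegral.integral_congr fun x hx => ?_
  simp only [hF x hx, hG x hx]

theorem integral_deriv_comp_mul {g h : ℝ → ℝ} (hg : IntervalIntegrable g volume a b)
    (hh : ContDiff ℝ 1 h) :
    ∫ x in a..b, deriv h (∫ t in a..x, g t) * g x = h (∫ t in a..b, g t) - h 0 := by
  have hac := absolutelyContinuousOnInterval_intervalIntegral hg
  obtain ⟨C, hC⟩ := hac.exists_bound
  obtain ⟨K, hK⟩ := hh.contDiffOn.exists_lipschitzOnWith one_ne_zero
    (convex_closedBall (0 : ℝ) C) (isCompact_closedBall 0 C)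
  have hcomp := absolutelyContinuousOnInterval_comp_of_lipschitzOnWith hK hac
    fun x hx => mem_closedBall_zero_iff.2 (hC x hx)
  have hint : IntervalIntegrable (fun x => deriv h (∫ t in a..x, g t) * g x) volume a b :=
    hg.continuousOn_mul ((hh.continuous_deriv le_rfl).comp_continuousOn hac.continuousOn)
  rw [integral_eq_sub_of_absolutelyContinuousOnInterval hint hcomp,
    intervalIntegral.integral_same]
  filter_upwards [hg.ae_hasDerivAt_integral] with x hgx hx
  exact (hh.differentiable one_ne_zero _).hasDerivAt.comp x (hgx hx a left_mem_uIcc)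

theorem integral_neg_exp_neg_integral_mul {g : ℝ → ℝ} (hg : IntervalIntegrable g volume a b) :
    ∫ x in a..b, -Real.exp (-∫ t in a..x, g t) * g x = Real.exp (-∫ t in a..b, g t) - 1 := by
  simpa [_root_.deriv_comp_neg] using
    integral_deriv_comp_mul (h := fun s => Real.exp (-s)) hg (by fun_prop)

theorem le_mul_exp_integral_of_le_add_integral {g w : ℝ → ℝ} {B : ℝ} (hab : a ≤ b)
    (hg : IntervalIntegrable g volume a b) (hg0 : ∀ x ∈ Icc a b, 0 ≤ g x)
    (hw : ContinuousOn w (Icc a b))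
    (hle : ∀ x ∈ Icc a b, w x ≤ B + ∫ t in a..x, g t * w t) :
    w b ≤ B * Real.exp (∫ t in a..b, g t) := by
  rw [← uIcc_of_le hab] at hg0 hw hle
  set e : ℝ → ℝ := fun x => Real.exp (-∫ t in a..x, g t) with he
  set W : ℝ → ℝ := fun x => ∫ t in a..x, g t * w t with hW
  have hec : ContinuousOn e (uIcc a b) :=
    (absolutelyContinuousOnInterval_intervalIntegral hg).continuousOn.neg.rexp
  have heint : IntervalIntegrable (fun x => -e x * g x) volume a b := hg.continuousOn_mul hec.neg
  have hWint : IntervalIntegrable (fun x => g x * w x) volume a b := hg.mul_continuousOn hw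
  have hWc : ContinuousOn W (uIcc a b) :=
    (absolutelyContinuousOnInterval_intervalIntegral hWint).continuousOn
  have he_eq (x : ℝ) (hx : x ∈ uIcc a b) : e x = e a + ∫ t in a..x, -e t * g t := by
    rw [integral_neg_exp_neg_integral_mul
      (hg.mono_set (uIcc_subset_uIcc left_mem_uIcc hx))]
    simp [he]
  have hprod : e b * W b ≤ B * (1 - e b) := by
    calc e b * W b
        = ∫ x in a..b, (-e x * g x * W x + e x * (g x * w x)) := by
          rw [← mul_sub_mul_eq_integral heint hWint he_eq fun x _ => by simp [hW]]
          simp [hW]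
      _ ≤ ∫ x in a..b, -B * (-e x * g x) := by
          refine intervalIntegral.integral_mono_on hab ((heint.mul_continuousOn hWc).add
            (hWint.continuousOn_mul hec)) (heint.const_mul _) fun x hx => ?_
          rw [← uIcc_of_le hab] at hx
          linarith [mul_le_mul_of_nonneg_left (hle x hx)
            (mul_nonneg (Real.exp_pos (-∫ t in a..x, g t)).le (hg0 x hx))]
      _ = B * (1 - e b) := by
          rw [intervalIntegral.integral_const_mul, integral_neg_exp_neg_integral_mul hg]
          ring
  calc w b ≤ B + W b := hle b right_mem_uIcc
    _ ≤ B / e b := by rw [le_div_iff₀ (Real.exp_pos _)]; linarith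
    _ = B * Real.exp (∫ t in a..b, g t) := by simp only [he, Real.exp_neg, div_inv_eq_mul]

end Primitive

theorem uIcc_zero_subset_Ici {x : ℝ} (hx : 0 ≤ x) : uIcc 0 x ⊆ Ici (0 : ℝ) := by
  rw [uIcc_of_le hx]
  exact Icc_subset_Ici_self

theorem Icc_add_one_mem_nhdsWithin_Ici (a x : ℝ) : Icc a (x + 1) ∈ 𝓝[Ici a] x := by
  rw [← Ici_inter_Iic]
  exact inter_mem self_mem_nhdsWithin
    (mem_nhdsWithin_of_mem_nhds (Iic_mem_nhds (lt_add_one x)))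

theorem continuousOn_Ici_zero_of_forall_uIcc {X : Type*} [TopologicalSpace X] {Y : ℝ → X}
    (hY : ∀ b, 0 ≤ b → ContinuousOn Y (uIcc 0 b)) : ContinuousOn Y (Ici 0) := by
  intro x (hx : 0 ≤ x)
  have hcont := hY (x + 1) (by positivity)
  rw [uIcc_of_le (by positivity)] at hcont
  exact (hcont x ⟨hx, by linarith⟩).mono_of_mem_nhdsWithin (Icc_add_one_mem_nhdsWithin_Ici 0 x)

theorem hasDerivWithinAt_Ici_zero_of_eq_add_integral {E : Type*} [NormedAddCommGroup E]
    [NormedSpace ℝ E] [CompleteSpace E] {f F : ℝ → E} (hf : ContinuousOn f (Ici 0))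
    (hF : ∀ x, 0 ≤ x → F x = F 0 + ∫ t in (0 : ℝ)..x, f t) {x : ℝ} (hx : 0 ≤ x) :
    HasDerivWithinAt F (f x) (Ici 0) x := by
  have hfIcc : ContinuousOn f (Icc 0 (x + 1)) := hf.mono Icc_subset_Ici_self
  have : Fact (x ∈ Icc 0 (x + 1)) := ⟨hx, by linarith⟩
  have hderiv : HasDerivWithinAt (fun u => ∫ t in (0 : ℝ)..u, f t) (f x) (Icc 0 (x + 1)) x :=
    intervalIntegral.integral_hasDerivWithinAt_right
      (hf.mono (uIcc_zero_subset_Ici hx)).intervalIntegrable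
      (hfIcc.stronglyMeasurableAtFilter_nhdsWithin measurableSet_Icc x) (hfIcc x this.out)
  exact ((hderiv.const_add (F 0)).congr (fun t ht => hF t ht.1) (hF x hx)).mono_of_mem_nhdsWithin
    (Icc_add_one_mem_nhdsWithin_Ici 0 x)

section Caratheodory

open scoped Nat

variable {𝕜 E : Type*} [RCLike 𝕜] [NormedAddCommGroup E] [NormedSpace 𝕜 E]
  {A B : ℝ → E →L[𝕜] E}

theorem intervalIntegrable_clm_apply {a b : ℝ} {Y : ℝ → E} (hA : IntervalIntegrable A volume a b)
    (hY : ContinuousOn Y (uIcc a b)) : IntervalIntegrable (fun t => A t (Y t)) volume a b := by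
  rw [intervalIntegrable_iff] at hA ⊢
  obtain ⟨C, hC⟩ := isCompact_uIcc.exists_bound_of_continuousOn hY
  have hYm : AEStronglyMeasurable Y (volume.restrict (uIoc a b)) :=
    (hY.mono uIoc_subset_uIcc).aestronglyMeasurable measurableSet_uIoc
  have hAYm : AEStronglyMeasurable (fun t => A t (Y t)) (volume.restrict (uIoc a b)) :=
    (isBoundedBilinearMap_apply (𝕜 := 𝕜)).continuous.comp_aestronglyMeasurable
      (hA.aestronglyMeasurable.prodMk hYm)
  refine Integrable.mono' (hA.norm.mul_const C) hAYm ?_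
  filter_upwards [ae_restrict_mem measurableSet_uIoc] with t ht
  exact (A t).le_opNorm_of_le (hC t (uIoc_subset_uIcc ht))

variable [NormedSpace ℝ E]

/-- `Y` solves the linear system `Y' = A Y` on `[0, ∞)` in the sense of Carathéodory: it is
continuous and satisfies the integrated equation. -/
structure IsCaratheodorySolution (A : ℝ → E →L[𝕜] E) (Y : ℝ → E) : Prop where
  continuousOn : ContinuousOn Y (Ici 0)
  eq_add_integral : ∀ x, 0 ≤ x → Y x = Y 0 + ∫ t in (0 : ℝ)..x, A t (Y t)

theorem IsCaratheodorySolution.intervalIntegrable {Y : ℝ → E} (hY : IsCaratheodorySolution A Y)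
    {x : ℝ} (hx : 0 ≤ x) (hA : IntervalIntegrable A volume 0 x) :
    IntervalIntegrable (fun t => A t (Y t)) volume 0 x :=
  intervalIntegrable_clm_apply hA (hY.continuousOn.mono (uIcc_zero_subset_Ici hx))

theorem IsCaratheodorySolution.norm_sub_le_add_integral {Y W : ℝ → E}
    (hY : IsCaratheodorySolution A Y) (hW : IsCaratheodorySolution B W) {x C : ℝ} (hx : 0 ≤ x)
    (hA : IntervalIntegrable A volume 0 x) (hB : IntervalIntegrable B volume 0 x)
    (hC : ∀ t ∈ Icc 0 x, ‖W t‖ ≤ C) :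
    ‖Y x - W x‖ ≤ ‖Y 0 - W 0‖ + C * (∫ t in (0 : ℝ)..x, ‖A t - B t‖) +
      ∫ t in (0 : ℝ)..x, ‖A t‖ * ‖Y t - W t‖ := by
  have hAB : IntervalIntegrable (fun t => C * ‖A t - B t‖) volume 0 x :=
    (hA.sub hB).norm.const_mul C
  have hAYW : IntervalIntegrable (fun t => ‖A t‖ * ‖Y t - W t‖) volume 0 x :=
    hA.norm.mul_continuousOn
      ((hY.continuousOn.sub hW.continuousOn).norm.mono (uIcc_zero_subset_Ici hx))
  have hpoint (t : ℝ) (ht : t ∈ Ioc 0 x) :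
      ‖A t (Y t) - B t (W t)‖ ≤ C * ‖A t - B t‖ + ‖A t‖ * ‖Y t - W t‖ := by
    calc ‖A t (Y t) - B t (W t)‖ = ‖(A t - B t) (W t) + A t (Y t - W t)‖ := by
          rw [sub_apply, map_sub, sub_add_sub_cancel']
      _ ≤ ‖A t - B t‖ * C + ‖A t‖ * ‖Y t - W t‖ :=
          norm_add_le_of_le ((A t - B t).le_opNorm_of_le (hC t (Ioc_subset_Icc_self ht)))
            ((A t).le_opNorm _)
      _ = C * ‖A t - B t‖ + ‖A t‖ * ‖Y t - W t‖ := by rw [mul_comm C]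
  calc ‖Y x - W x‖ = ‖(Y 0 - W 0) + ∫ t in (0 : ℝ)..x, (A t (Y t) - B t (W t))‖ := by
        rw [hY.eq_add_integral x hx, hW.eq_add_integral x hx, intervalIntegral.integral_sub
          (hY.intervalIntegrable hx hA) (hW.intervalIntegrable hx hB), add_sub_add_comm]
    _ ≤ ‖Y 0 - W 0‖ + ∫ t in (0 : ℝ)..x, (C * ‖A t - B t‖ + ‖A t‖ * ‖Y t - W t‖) :=
        norm_add_le_of_le le_rfl (intervalIntegral.norm_integral_le_of_norm_le hx
          (ae_of_all _ hpoint) (hAB.add hAYW))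
    _ = ‖Y 0 - W 0‖ + C * (∫ t in (0 : ℝ)..x, ‖A t - B t‖) +
          ∫ t in (0 : ℝ)..x, ‖A t‖ * ‖Y t - W t‖ := by
        rw [intervalIntegral.integral_add hAB hAYW, intervalIntegral.integral_const_mul, add_assoc]

theorem IsCaratheodorySolution.norm_sub_le {Y W : ℝ → E} (hY : IsCaratheodorySolution A Y)
    (hW : IsCaratheodorySolution B W) {b C : ℝ} (hb : 0 ≤ b)
    (hA : IntervalIntegrable A volume 0 b) (hB : IntervalIntegrable B volume 0 b)
    (hC : ∀ t ∈ Icc 0 b, ‖W t‖ ≤ C) :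
    ‖Y b - W b‖ ≤ (‖Y 0 - W 0‖ + C * ∫ t in (0 : ℝ)..b, ‖A t - B t‖) *
      Real.exp (∫ t in (0 : ℝ)..b, ‖A t‖) := by
  refine le_mul_exp_integral_of_le_add_integral (w := fun x => ‖Y x - W x‖) hb hA.norm
    (fun x _ => norm_nonneg _) ((hY.continuousOn.sub hW.continuousOn).norm.mono
      Icc_subset_Ici_self) fun x hx => ?_
  have hsub : uIcc 0 x ⊆ uIcc 0 b := by
    rw [uIcc_of_le hb, uIcc_of_le hx.1]
    exact Icc_subset_Icc_right hx.2
  refine (hY.norm_sub_le_add_integral hW hx.1 (hA.mono_set hsub) (hB.mono_set hsub)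
    fun t ht => hC t ⟨ht.1, ht.2.trans hx.2⟩).trans ?_
  have hC0 : 0 ≤ C := (norm_nonneg _).trans (hC 0 (left_mem_Icc.2 hb))
  gcongr ‖Y 0 - W 0‖ + C * ?_ + _
  exact intervalIntegral.integral_mono_interval le_rfl hx.1 hx.2
    (ae_of_all _ fun t => norm_nonneg _) (hA.sub hB).norm

theorem IsCaratheodorySolution.eqOn {Y W : ℝ → E} (hY : IsCaratheodorySolution A Y)
    (hW : IsCaratheodorySolution A W) (hA : ∀ a b, IntervalIntegrable A volume a b)
    (h0 : Y 0 = W 0) : EqOn Y W (Ici 0) := by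
  intro x (hx : 0 ≤ x)
  obtain ⟨C, hC⟩ := isCompact_Icc.exists_bound_of_continuousOn
    (hW.continuousOn.mono (Icc_subset_Ici_self : Icc 0 x ⊆ Ici 0))
  have hle := hY.norm_sub_le hW hx (hA 0 x) (hA 0 x) hC
  simp only [h0, sub_self, norm_zero, intervalIntegral.integral_zero, mul_zero, add_zero,
    zero_mul] at hle
  exact sub_eq_zero.1 (norm_le_zero_iff.1 hle)

theorem IsCaratheodorySolution.tendsto {ι : Type*} {l : Filter ι} {A : ι → ℝ → E →L[𝕜] E}
    {Y : ι → ℝ → E} {W : ℝ → E} {x : ℝ} (hx : 0 ≤ x)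
    (hY : ∀ i, IsCaratheodorySolution (A i) (Y i)) (hW : IsCaratheodorySolution B W)
    (hA : ∀ i, IntervalIntegrable (A i) volume 0 x) (hB : IntervalIntegrable B volume 0 x)
    (hAB : Tendsto (fun i => ∫ t in (0 : ℝ)..x, ‖A i t - B t‖) l (𝓝 0))
    (h0 : Tendsto (fun i => Y i 0) l (𝓝 (W 0))) : Tendsto (fun i => Y i x) l (𝓝 (W x)) := by
  obtain ⟨C, hC⟩ := isCompact_Icc.exists_bound_of_continuousOn
    (hW.continuousOn.mono (Icc_subset_Ici_self : Icc 0 x ⊆ Ici 0))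
  have hC0 : 0 ≤ C := (norm_nonneg _).trans (hC 0 (left_mem_Icc.2 hx))
  have hAle (i : ι) : ∫ t in (0 : ℝ)..x, ‖A i t‖ ≤
      (∫ t in (0 : ℝ)..x, ‖A i t - B t‖) + ∫ t in (0 : ℝ)..x, ‖B t‖ := by
    rw [← intervalIntegral.integral_add ((hA i).sub hB).norm hB.norm]
    refine intervalIntegral.integral_mono_on hx (hA i).norm (((hA i).sub hB).norm.add hB.norm)
      fun t _ => ?_
    simpa using norm_add_le (A i t - B t) (B t)
  have hlim := ((tendsto_iff_norm_sub_tendsto_zero.1 h0).add (hAB.const_mul C)).mul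
    (hAB.add_const (∫ t in (0 : ℝ)..x, ‖B t‖)).rexp
  rw [mul_zero, add_zero, zero_mul] at hlim
  refine tendsto_iff_norm_sub_tendsto_zero.2 (squeeze_zero (fun i => norm_nonneg _)
    (fun i => ?_) hlim)
  refine ((hY i).norm_sub_le hW hx (hA i) hB hC).trans ?_
  have hint0 : 0 ≤ ∫ t in (0 : ℝ)..x, ‖A i t - B t‖ :=
    intervalIntegral.integral_nonneg hx fun t _ => norm_nonneg _
  gcongr
  exact hAle i

theorem IsCaratheodorySolution.smul_add_smul [SMulCommClass 𝕜 ℝ E] {Y W : ℝ → E}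
    (hY : IsCaratheodorySolution A Y) (hW : IsCaratheodorySolution A W)
    (hA : ∀ a b, IntervalIntegrable A volume a b) (c d : 𝕜) :
    IsCaratheodorySolution A fun x => c • Y x + d • W x where
  continuousOn := (hY.continuousOn.const_smul c).add (hW.continuousOn.const_smul d)
  eq_add_integral x hx := by
    have hcY : IntervalIntegrable (fun t => c • A t (Y t)) volume 0 x :=
      (hY.intervalIntegrable hx (hA 0 x)).smul c
    have hdW : IntervalIntegrable (fun t => d • A t (W t)) volume 0 x :=
      (hW.intervalIntegrable hx (hA 0 x)).smul d
    simp only [map_add, map_smul]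
    rw [intervalIntegral.integral_add hcY hdW, intervalIntegral.integral_smul,
      intervalIntegral.integral_smul, hY.eq_add_integral x hx, hW.eq_add_integral x hx]
    module

theorem IsCaratheodorySolution.comp_add_right {Y : ℝ → E} (hY : IsCaratheodorySolution A Y)
    (hA : ∀ a b, IntervalIntegrable A volume a b) {T : ℝ} (hT : 0 ≤ T) (hper : A.Periodic T) :
    IsCaratheodorySolution A fun x => Y (x + T) where
  continuousOn := hY.continuousOn.comp (by fun_prop) fun x (hx : 0 ≤ x) => add_nonneg hx hT
  eq_add_integral x hx := by
    have hYT := hY.intervalIntegrable hT (hA 0 T)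
    have hYxT := hY.intervalIntegrable (add_nonneg hx hT) (hA 0 (x + T))
    have hshift : ∫ t in (0 : ℝ)..x, A t (Y (t + T)) = ∫ t in T..x + T, A t (Y t) := by
      simpa [hper _] using
        intervalIntegral.integral_comp_add_right (a := 0) (b := x) (fun t => A t (Y t)) T
    rw [hshift, zero_add, hY.eq_add_integral _ (add_nonneg hx hT), hY.eq_add_integral T hT,
      add_assoc, intervalIntegral.integral_add_adjacent_intervals hYT (hYT.symm.trans hYxT)]

/-- The terms of the Picard iteration for `Y' = A Y`, `Y(0) = Y₀`: the `n`-th one is the `n`-fold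
iterated integral of `A`, applied to `Y₀`. -/
noncomputable def picardTerm (A : ℝ → E →L[𝕜] E) (Y₀ : E) : ℕ → ℝ → E
  | 0 => fun _ => Y₀
  | n + 1 => fun x => ∫ t in (0 : ℝ)..x, A t (picardTerm A Y₀ n t)

/-- The solution of the initial value problem `Y' = A Y`, `Y(0) = Y₀`, as the sum of the Picard
iteration. -/
noncomputable def picardSeries (A : ℝ → E →L[𝕜] E) (Y₀ : E) (x : ℝ) : E :=
  ∑' n, picardTerm A Y₀ n x

theorem continuous_picardTerm (hA : ∀ a b, IntervalIntegrable A volume a b) (Y₀ : E) (n : ℕ) :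
    Continuous (picardTerm A Y₀ n) := by
  induction n with
  | zero => exact continuous_const
  | succ n ih =>
    exact intervalIntegral.continuous_primitive
      (fun a b => intervalIntegrable_clm_apply (hA a b) ih.continuousOn) 0

theorem integral_mul_pow_div_factorial {g : ℝ → ℝ} {a b : ℝ} (hg : IntervalIntegrable g volume a b)
    (n : ℕ) :
    ∫ x in a..b, g x * ((∫ t in a..x, g t) ^ n / n !) =
      (∫ t in a..b, g t) ^ (n + 1) / (n + 1)! := by
  have hderiv (s : ℝ) : deriv (fun s : ℝ => s ^ (n + 1) / (n + 1)!) s = s ^ n / n ! := by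
    rw [deriv_div_const, deriv_pow_field, Nat.factorial_succ]
    push_cast
    field_simp
  have hchain := integral_deriv_comp_mul (h := fun s => s ^ (n + 1) / (n + 1)!) hg (by fun_prop)
  simp only [hderiv, zero_pow n.succ_ne_zero, zero_div, sub_zero] at hchain
  simpa only [mul_comm] using hchain

theorem norm_picardTerm_le (hA : ∀ a b, IntervalIntegrable A volume a b) (Y₀ : E) (n : ℕ) {x : ℝ}
    (hx : 0 ≤ x) :
    ‖picardTerm A Y₀ n x‖ ≤ ‖Y₀‖ * ((∫ t in (0 : ℝ)..x, ‖A t‖) ^ n / n !) := by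
  induction n generalizing x with
  | zero => simp [picardTerm]
  | succ n ih =>
    have hG : Continuous fun x => ∫ t in (0 : ℝ)..x, ‖A t‖ :=
      intervalIntegral.continuous_primitive (fun a b => (hA a b).norm) 0
    calc ‖picardTerm A Y₀ (n + 1) x‖
        ≤ ∫ t in (0 : ℝ)..x, ‖Y₀‖ * (‖A t‖ * ((∫ s in (0 : ℝ)..t, ‖A s‖) ^ n / n !)) := by
          refine intervalIntegral.norm_integral_le_of_norm_le hx (ae_of_all _ fun t ht => ?_)
            (((hA 0 x).norm.mul_continuousOn ((hG.pow n).div_const _).continuousOn).const_mul _)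
          refine ((A t).le_opNorm _).trans ?_
          rw [mul_left_comm]
          gcongr
          exact ih ht.1.le
      _ = ‖Y₀‖ * ((∫ t in (0 : ℝ)..x, ‖A t‖) ^ (n + 1) / (n + 1)!) := by
          rw [intervalIntegral.integral_const_mul, integral_mul_pow_div_factorial (hA 0 x).norm]

theorem norm_picardTerm_le_of_mem_Icc (hA : ∀ a b, IntervalIntegrable A volume a b) (Y₀ : E)
    (n : ℕ) {x b : ℝ} (hx : x ∈ Icc 0 b) :
    ‖picardTerm A Y₀ n x‖ ≤ ‖Y₀‖ * ((∫ t in (0 : ℝ)..b, ‖A t‖) ^ n / n !) := by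
  refine (norm_picardTerm_le hA Y₀ n hx.1).trans ?_
  have hnonneg : 0 ≤ ∫ t in (0 : ℝ)..x, ‖A t‖ :=
    intervalIntegral.integral_nonneg hx.1 fun t _ => norm_nonneg _
  have hmono : ∫ t in (0 : ℝ)..x, ‖A t‖ ≤ ∫ t in (0 : ℝ)..b, ‖A t‖ :=
    intervalIntegral.integral_mono_interval le_rfl hx.1 hx.2
      (ae_of_all _ fun t => norm_nonneg _) (hA 0 b).norm
  gcongr

theorem picardSeries_zero (A : ℝ → E →L[𝕜] E) (Y₀ : E) : picardSeries A Y₀ 0 = Y₀ := by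
  rw [picardSeries, tsum_eq_single 0]
  · rfl
  · rintro (_ | n) hn
    · exact absurd rfl hn
    · exact intervalIntegral.integral_same

variable [CompleteSpace E]

theorem hasSum_picardTerm (hA : ∀ a b, IntervalIntegrable A volume a b) (Y₀ : E) {x : ℝ}
    (hx : 0 ≤ x) : HasSum (fun n => picardTerm A Y₀ n x) (picardSeries A Y₀ x) :=
  (Summable.of_norm_bounded ((Real.summable_pow_div_factorial _).mul_left _) fun n =>
    norm_picardTerm_le_of_mem_Icc hA Y₀ n ⟨hx, le_rfl⟩).hasSum

theorem hasSum_integral_picardTerm (hA : ∀ a b, IntervalIntegrable A volume a b) (Y₀ : E) {x : ℝ}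
    (hx : 0 ≤ x) :
    HasSum (fun n => picardTerm A Y₀ (n + 1) x)
      (∫ t in (0 : ℝ)..x, A t (picardSeries A Y₀ t)) := by
  have hmem {t : ℝ} (ht : t ∈ uIoc 0 x) : t ∈ Icc 0 x := by
    rw [uIoc_of_le hx] at ht
    exact Ioc_subset_Icc_self ht
  refine intervalIntegral.hasSum_integral_of_dominated_convergence
    (fun n t => ‖A t‖ * (‖Y₀‖ * ((∫ t in (0 : ℝ)..x, ‖A t‖) ^ n / n !))) (fun n => ?_)
    (fun n => ae_of_all _ fun t ht =>
      (A t).le_opNorm_of_le (norm_picardTerm_le_of_mem_Icc hA Y₀ n (hmem ht)))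
    (ae_of_all _ fun t _ => ((Real.summable_pow_div_factorial _).mul_left _).mul_left _) ?_
    (ae_of_all _ fun t ht => (A t).hasSum (hasSum_picardTerm hA Y₀ (hmem ht).1))
  · exact (intervalIntegrable_iff.1 (intervalIntegrable_clm_apply (hA 0 x)
      (continuous_picardTerm hA Y₀ n).continuousOn)).aestronglyMeasurable
  · simp only [tsum_mul_left]
    exact (hA 0 x).norm.mul_const _

theorem isCaratheodorySolution_picardSeries (hA : ∀ a b, IntervalIntegrable A volume a b)
    (Y₀ : E) : IsCaratheodorySolution A (picardSeries A Y₀) where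
  continuousOn := continuousOn_Ici_zero_of_forall_uIcc fun b hb => by
    rw [uIcc_of_le hb]
    exact continuousOn_tsum (fun n => (continuous_picardTerm hA Y₀ n).continuousOn)
      ((Real.summable_pow_div_factorial _).mul_left _) fun n x hx =>
        norm_picardTerm_le_of_mem_Icc hA Y₀ n hx
  eq_add_integral x hx := by
    rw [picardSeries_zero, ← (hasSum_integral_picardTerm hA Y₀ hx).tsum_eq]
    exact (hasSum_picardTerm hA Y₀ hx).summable.tsum_eq_zero_add

end Caratheodory

section System

variable {𝕜 : Type*} [RCLike 𝕜] {q : ℝ → ℝ} {z : 𝕜} {y dy : ℝ → 𝕜}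

/-- The coefficient of Hill's equation written as the first order system
`(y, y')' = (y', (q - z) y)`. -/
noncomputable def systemCoeff (q : ℝ → ℝ) (z : 𝕜) (t : ℝ) : 𝕜 × 𝕜 →L[𝕜] 𝕜 × 𝕜 :=
  (ContinuousLinearMap.inl 𝕜 𝕜 𝕜).comp (ContinuousLinearMap.snd 𝕜 𝕜 𝕜) +
    ((q t : 𝕜) - z) • (ContinuousLinearMap.inr 𝕜 𝕜 𝕜).comp (ContinuousLinearMap.fst 𝕜 𝕜 𝕜)

theorem systemCoeff_apply (q : ℝ → ℝ) (z : 𝕜) (t : ℝ) (v : 𝕜 × 𝕜) :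
    systemCoeff q z t v = (v.2, q t • v.1 - z * v.1) := by
  simp [systemCoeff, RCLike.real_smul_eq_coe_mul, sub_mul]

theorem norm_systemCoeff_sub_le (q : ℝ → ℝ) (z w : 𝕜) (t : ℝ) :
    ‖systemCoeff q z t - systemCoeff q w t‖ ≤ ‖z - w‖ := by
  refine ContinuousLinearMap.opNorm_le_bound _ (norm_nonneg _) fun v => ?_
  have hdiff : (systemCoeff q z t - systemCoeff q w t) v = (0, (w - z) * v.1) := by
    rw [sub_apply, systemCoeff_apply, systemCoeff_apply, Prod.mk_sub_mk, sub_self]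
    congr 1
    ring
  rw [hdiff, Prod.norm_mk, norm_zero, norm_mul, norm_sub_rev, max_eq_right (by positivity)]
  gcongr
  exact norm_fst_le v

/-- The pair `(y, y')` for the solution `y` of Hill's equation with `y 0 = a`, `y' 0 = b`, realised
as a Picard series. -/
noncomputable def solution (q : ℝ → ℝ) (z a b : 𝕜) : ℝ → 𝕜 × 𝕜 :=
  picardSeries (systemCoeff q z) (a, b)

theorem IsSolution.continuousOn (h : IsSolution q z y dy) : ContinuousOn y (Ici 0) :=
  fun x hx => (h.hasDeriv x hx).continuousWithinAt

variable (hq : ∀ a b, IntervalIntegrable q volume a b)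
include hq

theorem intervalIntegrable_systemCoeff (z : 𝕜) (a b : ℝ) :
    IntervalIntegrable (systemCoeff q z) volume a b := by
  have hcoe : IntervalIntegrable (fun t => (q t : 𝕜) - z) volume a b :=
    IntervalIntegrable.sub ⟨(hq a b).1.ofReal, (hq a b).2.ofReal⟩ intervalIntegrable_const
  exact intervalIntegrable_const.add ⟨hcoe.1.smul_const _, hcoe.2.smul_const _⟩

theorem intervalIntegrable_equation {x : ℝ} (hy : ContinuousOn y (Ici 0)) (hx : 0 ≤ x) (z : 𝕜) :
    IntervalIntegrable (fun t => q t • y t - z * y t) volume 0 x := by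
  have hyx := hy.mono (uIcc_zero_subset_Ici hx)
  simp only [RCLike.real_smul_eq_coe_mul]
  exact (IntervalIntegrable.mul_continuousOn ⟨(hq 0 x).1.ofReal, (hq 0 x).2.ofReal⟩ hyx).sub
    (hyx.intervalIntegrable.const_mul z)

theorem IsSolution.continuousOn_deriv (h : IsSolution q z y dy) : ContinuousOn dy (Ici 0) :=
  continuousOn_Ici_zero_of_forall_uIcc fun _ hb => continuousOn_of_eq_add_integral
    (intervalIntegrable_equation hq h.continuousOn hb z)
    fun x hx => h.equation x (uIcc_zero_subset_Ici hb hx)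

theorem IsSolution.eq_add_integral (h : IsSolution q z y dy) {x : ℝ} (hx : 0 ≤ x) :
    y x = y 0 + ∫ t in (0 : ℝ)..x, dy t := by
  rw [intervalIntegral.integral_eq_sub_of_hasDerivAt_of_le hx
    (h.continuousOn.mono Icc_subset_Ici_self)
    (fun t ht => (h.hasDeriv t ht.1.le).hasDerivAt (Ici_mem_nhds ht.1))
    ((h.continuousOn_deriv hq).mono (uIcc_zero_subset_Ici hx)).intervalIntegrable,
    add_sub_cancel]

theorem integral_systemCoeff {x : ℝ} (hy : ContinuousOn y (Ici 0)) (hdy : ContinuousOn dy (Ici 0))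
    (hx : 0 ≤ x) (z : 𝕜) :
    ∫ t in (0 : ℝ)..x, systemCoeff q z t (y t, dy t) =
      (∫ t in (0 : ℝ)..x, dy t, ∫ t in (0 : ℝ)..x, (q t • y t - z * y t)) := by
  have hint := intervalIntegrable_clm_apply (intervalIntegrable_systemCoeff hq z 0 x)
    ((hy.prodMk hdy).mono (uIcc_zero_subset_Ici hx))
  have hfst := (ContinuousLinearMap.fst ℝ 𝕜 𝕜).intervalIntegral_comp_comm hint
  have hsnd := (ContinuousLinearMap.snd ℝ 𝕜 𝕜).intervalIntegral_comp_comm hint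
  simp only [systemCoeff_apply, ContinuousLinearMap.coe_fst', ContinuousLinearMap.coe_snd']
    at hfst hsnd
  simp only [systemCoeff_apply]
  exact Prod.ext hfst.symm hsnd.symm

theorem isSolution_iff_isCaratheodorySolution :
    IsSolution q z y dy ↔ IsCaratheodorySolution (systemCoeff q z) fun x => (y x, dy x) := by
  constructor
  · intro h
    have hdy := h.continuousOn_deriv hq
    refine ⟨h.continuousOn.prodMk hdy, fun x hx => ?_⟩
    rw [integral_systemCoeff hq h.continuousOn hdy hx, Prod.mk_add_mk, ← h.eq_add_integral hq hx,
      ← h.equation x hx]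
  · intro h
    have hy : ContinuousOn y (Ici 0) := h.continuousOn.fst
    have hdy : ContinuousOn dy (Ici 0) := h.continuousOn.snd
    have heq (x : ℝ) (hx : 0 ≤ x) : y x = y 0 + ∫ t in (0 : ℝ)..x, dy t ∧
        dy x = dy 0 + ∫ t in (0 : ℝ)..x, (q t • y t - z * y t) := by
      simpa [integral_systemCoeff hq hy hdy hx] using h.eq_add_integral x hx
    exact ⟨fun x => hasDerivWithinAt_Ici_zero_of_eq_add_integral hdy fun x hx => (heq x hx).1,
      fun x hx => (heq x hx).2⟩

theorem isSolutionIVP_solution (z a b : 𝕜) :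
    IsSolutionIVP q z a b (fun x => (solution q z a b x).1) fun x => (solution q z a b x).2 where
  toIsSolution := (isSolution_iff_isCaratheodorySolution hq).2
    (isCaratheodorySolution_picardSeries (intervalIntegrable_systemCoeff hq z) (a, b))
  init := congrArg Prod.fst (picardSeries_zero (systemCoeff q z) (a, b))
  init_deriv := congrArg Prod.snd (picardSeries_zero (systemCoeff q z) (a, b))

theorem IsSolution.eq_of_init_eq {y₁ dy₁ y₂ dy₂ : ℝ → 𝕜} (h₁ : IsSolution q z y₁ dy₁)
    (h₂ : IsSolution q z y₂ dy₂) (h0 : y₁ 0 = y₂ 0) (hd0 : dy₁ 0 = dy₂ 0) {x : ℝ} (hx : 0 ≤ x) :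
    y₁ x = y₂ x ∧ dy₁ x = dy₂ x :=
  Prod.ext_iff.1 <| ((isSolution_iff_isCaratheodorySolution hq).1 h₁).eqOn
    ((isSolution_iff_isCaratheodorySolution hq).1 h₂) (intervalIntegrable_systemCoeff hq z)
    (Prod.ext h0 hd0) hx

theorem IsSolution.linearCombination {y₁ dy₁ y₂ dy₂ : ℝ → 𝕜} (h₁ : IsSolution q z y₁ dy₁)
    (h₂ : IsSolution q z y₂ dy₂) (c d : 𝕜) :
    IsSolution q z (fun x => c * y₁ x + d * y₂ x) fun x => c * dy₁ x + d * dy₂ x :=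
  (isSolution_iff_isCaratheodorySolution hq).2 <|
    ((isSolution_iff_isCaratheodorySolution hq).1 h₁).smul_add_smul
      ((isSolution_iff_isCaratheodorySolution hq).1 h₂) (intervalIntegrable_systemCoeff hq z) c d

theorem IsSolution.comp_add_right (h : IsSolution q z y dy) {ℓ : ℝ} (hℓ : 0 ≤ ℓ)
    (hper : q.Periodic ℓ) : IsSolution q z (fun x => y (x + ℓ)) fun x => dy (x + ℓ) :=
  (isSolution_iff_isCaratheodorySolution hq).2 <|
    ((isSolution_iff_isCaratheodorySolution hq).1 h).comp_add_right
      (intervalIntegrable_systemCoeff hq z) hℓ fun x => by simp only [systemCoeff, hper x]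

theorem tendsto_solution {ι : Type*} {l : Filter ι} {ζ : ι → 𝕜} (hζ : Tendsto ζ l (𝓝 z))
    {Y dY : ι → ℝ → 𝕜} (hY : ∀ i, IsSolution q (ζ i) (Y i) (dY i)) (hy : IsSolution q z y dy)
    (h0 : ∀ i, Y i 0 = y 0) (hd0 : ∀ i, dY i 0 = dy 0) {x : ℝ} (hx : 0 ≤ x) :
    Tendsto (fun i => (Y i x, dY i x)) l (𝓝 (y x, dy x)) := by
  refine IsCaratheodorySolution.tendsto (Y := fun i x => (Y i x, dY i x))
    (W := fun x => (y x, dy x)) hx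
    (fun i => (isSolution_iff_isCaratheodorySolution hq).1 (hY i))
    ((isSolution_iff_isCaratheodorySolution hq).1 hy)
    (fun i => intervalIntegrable_systemCoeff hq (ζ i) 0 x)
    (intervalIntegrable_systemCoeff hq z 0 x) ?_ (by simp only [h0, hd0, tendsto_const_nhds])
  refine squeeze_zero (fun i => intervalIntegral.integral_nonneg hx fun t _ => norm_nonneg _)
    (fun i => ?_) (by simpa using (tendsto_iff_norm_sub_tendsto_zero.1 hζ).mul_const x)
  calc ∫ t in (0 : ℝ)..x, ‖systemCoeff q (ζ i) t - systemCoeff q z t‖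
      ≤ ∫ _ in (0 : ℝ)..x, ‖ζ i - z‖ := intervalIntegral.integral_mono_on hx
        ((intervalIntegrable_systemCoeff hq _ 0 x).sub
          (intervalIntegrable_systemCoeff hq z 0 x)).norm intervalIntegrable_const
        fun t _ => norm_systemCoeff_sub_le q (ζ i) z t
    _ = ‖ζ i - z‖ * x := by simp [mul_comm]

theorem IsSolution.map {𝕜' : Type*} [RCLike 𝕜'] (h : IsSolution q z y dy) (σ : 𝕜 →ₐ[ℝ] 𝕜') :
    IsSolution q (σ z) (fun x => σ (y x)) fun x => σ (dy x) where
  hasDeriv x hx :=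
    (LinearMap.toContinuousLinearMap σ.toLinearMap).hasFDerivAt.comp_hasDerivWithinAt x
      (h.hasDeriv x hx)
  equation x hx := by
    have hint := intervalIntegrable_equation hq h.continuousOn hx z
    have hcomm := (LinearMap.toContinuousLinearMap σ.toLinearMap).intervalIntegral_comp_comm hint
    simp only [LinearMap.coe_toContinuousLinearMap', AlgHom.toLinearMap_apply, map_sub, map_mul,
      map_smul] at hcomm
    rw [h.equation x hx, map_add, hcomm]

end System

section Wronskian

open scoped ComplexConjugate

variable {𝕜 : Type*} [RCLike 𝕜] {q : ℝ → ℝ} {y₁ dy₁ y₂ dy₂ : ℝ → 𝕜}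

/-- The Wronskian of two functions whose derivatives are given separately, as in `IsSolution`. -/
def wronskian (y₁ dy₁ y₂ dy₂ : ℝ → 𝕜) (x : ℝ) : 𝕜 := y₁ x * dy₂ x - y₂ x * dy₁ x

variable (hq : ∀ a b, IntervalIntegrable q volume a b)
include hq

theorem IsSolution.mul_deriv_sub {z₁ z₂ : 𝕜} (h₁ : IsSolution q z₁ y₁ dy₁)
    (h₂ : IsSolution q z₂ y₂ dy₂) {x : ℝ} (hx : 0 ≤ x) :
    y₁ x * dy₂ x - y₁ 0 * dy₂ 0 =
      ∫ t in (0 : ℝ)..x, (dy₁ t * dy₂ t + y₁ t * (q t • y₂ t - z₂ * y₂ t)) :=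
  mul_sub_mul_eq_integral
    ((h₁.continuousOn_deriv hq).mono (uIcc_zero_subset_Ici hx)).intervalIntegrable
    (intervalIntegrable_equation hq h₂.continuousOn hx z₂)
    (fun _ ht => h₁.eq_add_integral hq (uIcc_zero_subset_Ici hx ht))
    fun t ht => h₂.equation t (uIcc_zero_subset_Ici hx ht)

theorem IsSolution.wronskian_sub_wronskian_zero {z₁ z₂ : 𝕜} (h₁ : IsSolution q z₁ y₁ dy₁)
    (h₂ : IsSolution q z₂ y₂ dy₂) {x : ℝ} (hx : 0 ≤ x) :
    wronskian y₁ dy₁ y₂ dy₂ x - wronskian y₁ dy₁ y₂ dy₂ 0 =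
      (z₁ - z₂) * ∫ t in (0 : ℝ)..x, y₁ t * y₂ t := by
  have hint {w₁ dw₁ w₂ dw₂ : ℝ → 𝕜} {ζ₁ ζ₂ : 𝕜} (k₁ : IsSolution q ζ₁ w₁ dw₁)
      (k₂ : IsSolution q ζ₂ w₂ dw₂) : IntervalIntegrable
        (fun t => dw₁ t * dw₂ t + w₁ t * (q t • w₂ t - ζ₂ * w₂ t)) volume 0 x := by
    have hsub := uIcc_zero_subset_Ici hx
    exact (((k₁.continuousOn_deriv hq).mul (k₂.continuousOn_deriv hq)).mono
      hsub).intervalIntegrable.add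
        ((intervalIntegrable_equation hq k₂.continuousOn hx ζ₂).continuousOn_mul
          (k₁.continuousOn.mono hsub))
  calc wronskian y₁ dy₁ y₂ dy₂ x - wronskian y₁ dy₁ y₂ dy₂ 0
      = (y₁ x * dy₂ x - y₁ 0 * dy₂ 0) - (y₂ x * dy₁ x - y₂ 0 * dy₁ 0) := by
        simp only [wronskian]
        ring
    _ = ∫ t in (0 : ℝ)..x, ((dy₁ t * dy₂ t + y₁ t * (q t • y₂ t - z₂ * y₂ t)) -
          (dy₂ t * dy₁ t + y₂ t * (q t • y₁ t - z₁ * y₁ t))) := by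
        rw [h₁.mul_deriv_sub hq h₂ hx, h₂.mul_deriv_sub hq h₁ hx,
          intervalIntegral.integral_sub (hint h₁ h₂) (hint h₂ h₁)]
    _ = (z₁ - z₂) * ∫ t in (0 : ℝ)..x, y₁ t * y₂ t := by
        rw [← intervalIntegral.integral_const_mul]
        refine intervalIntegral.integral_congr fun t _ => ?_
        simp only [RCLike.real_smul_eq_coe_mul]
        ring

theorem IsSolution.wronskian_eq_wronskian_zero {z : 𝕜} (h₁ : IsSolution q z y₁ dy₁)
    (h₂ : IsSolution q z y₂ dy₂) {x : ℝ} (hx : 0 ≤ x) :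
    wronskian y₁ dy₁ y₂ dy₂ x = wronskian y₁ dy₁ y₂ dy₂ 0 := by
  rw [← sub_eq_zero, h₁.wronskian_sub_wronskian_zero hq h₂ hx, sub_self, zero_mul]

theorem IsSolution.im_mul_integral_norm_sq {z : ℂ} {y dy : ℝ → ℂ} (h : IsSolution q z y dy) {x : ℝ}
    (hx : 0 ≤ x) :
    z.im * ∫ t in (0 : ℝ)..x, ‖y t‖ ^ 2 = (conj (y 0) * dy 0).im - (conj (y x) * dy x).im := by
  have hwronskian (t : ℝ) : wronskian (fun t => conj (y t)) (fun t => conj (dy t)) y dy t =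
      2 * Complex.I * (conj (y t) * dy t).im := by
    rw [mul_right_comm, ← Complex.ofReal_ofNat, ← Complex.ofReal_mul, ← Complex.sub_conj, map_mul,
      Complex.conj_conj, wronskian]
  have hlagrange := (h.map hq Complex.conjAe.toAlgHom).wronskian_sub_wronskian_zero hq h hx
  have hint : ∫ t in (0 : ℝ)..x, conj (y t) * y t = ((∫ t in (0 : ℝ)..x, ‖y t‖ ^ 2 : ℝ) : ℂ) := by
    simp only [Complex.conj_mul', ← Complex.ofReal_pow, intervalIntegral.integral_ofReal]
  have hconj (w : ℂ) : Complex.conjAe.toAlgHom w = conj w := rfl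
  simp only [hconj] at hlagrange
  rw [hwronskian, hwronskian, hint, ← neg_sub z, Complex.sub_conj] at hlagrange
  have hI : (2 * Complex.I : ℂ) ≠ 0 := by simp
  apply Complex.ofReal_injective
  refine mul_left_cancel₀ hI ?_
  push_cast at hlagrange ⊢
  linear_combination hlagrange

end Wronskian

section Monodromy

open Matrix

variable {𝕜 : Type*} [RCLike 𝕜] {q : ℝ → ℝ} {ℓ : ℝ} {z : 𝕜} {y dy : ℝ → 𝕜}

/-- The monodromy matrix of Hill's equation over `[0, ℓ]`: it maps the initial values `(y 0, y' 0)`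
of a solution to `(y ℓ, y' ℓ)`. Its trace is Hill's discriminant. -/
noncomputable def monodromy (q : ℝ → ℝ) (ℓ : ℝ) (z : 𝕜) : Matrix (Fin 2) (Fin 2) 𝕜 :=
  !![(solution q z 1 0 ℓ).1, (solution q z 0 1 ℓ).1;
    (solution q z 1 0 ℓ).2, (solution q z 0 1 ℓ).2]

variable (hq : ∀ a b, IntervalIntegrable q volume a b)
include hq

theorem IsSolution.monodromy_mulVec (h : IsSolution q z y dy) (hℓ : 0 ≤ ℓ) :
    monodromy q ℓ z *ᵥ ![y 0, dy 0] = ![y ℓ, dy ℓ] := by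
  have hu := isSolutionIVP_solution hq z 1 0
  have hv := isSolutionIVP_solution hq z 0 1
  obtain ⟨hy, hdy⟩ := h.eq_of_init_eq hq
    (hu.toIsSolution.linearCombination hq hv.toIsSolution (y 0) (dy 0))
    (by simp [hu.init, hv.init]) (by simp [hu.init_deriv, hv.init_deriv]) hℓ
  rw [hy, hdy, monodromy]
  ext i
  fin_cases i <;> simp [mul_comm]

theorem monodromy_eq {u du v dv : ℝ → 𝕜} (hu : IsSolutionIVP q z 1 0 u du)
    (hv : IsSolutionIVP q z 0 1 v dv) (hℓ : 0 ≤ ℓ) :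
    monodromy q ℓ z = !![u ℓ, v ℓ; du ℓ, dv ℓ] := by
  have hcol₀ := hu.toIsSolution.monodromy_mulVec hq hℓ
  have hcol₁ := hv.toIsSolution.monodromy_mulVec hq hℓ
  rw [hu.init, hu.init_deriv] at hcol₀
  rw [hv.init, hv.init_deriv] at hcol₁
  ext i j
  have h₀ := congrFun hcol₀ i
  have h₁ := congrFun hcol₁ i
  fin_cases i <;> fin_cases j <;> simp_all [mulVec, dotProduct]

theorem det_monodromy (hℓ : 0 ≤ ℓ) (z : 𝕜) : (monodromy q ℓ z).det = 1 := by
  have hu := isSolutionIVP_solution hq z 1 0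
  have hv := isSolutionIVP_solution hq z 0 1
  have hwronskian := hu.toIsSolution.wronskian_eq_wronskian_zero hq hv.toIsSolution hℓ
  simp only [wronskian, hu.init, hu.init_deriv, hv.init, hv.init_deriv] at hwronskian
  rw [monodromy, det_fin_two_of, hwronskian]
  ring

theorem monodromy_algHom {𝕜' : Type*} [RCLike 𝕜'] (σ : 𝕜 →ₐ[ℝ] 𝕜') (hℓ : 0 ≤ ℓ) (z : 𝕜) :
    monodromy q ℓ (σ z) = (monodromy q ℓ z).map σ := by
  have hmap {a b : 𝕜} {a' b' : 𝕜'} (ha : σ a = a') (hb : σ b = b') : IsSolutionIVP q (σ z) a' b'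
      (fun x => σ (solution q z a b x).1) fun x => σ (solution q z a b x).2 :=
    have h := isSolutionIVP_solution hq z a b
    ⟨h.toIsSolution.map hq σ, (congrArg σ h.init).trans ha, (congrArg σ h.init_deriv).trans hb⟩
  rw [monodromy_eq hq (hmap (map_one σ) (map_zero σ)) (hmap (map_zero σ) (map_one σ)) hℓ]
  ext i j
  fin_cases i <;> fin_cases j <;> rfl

theorem continuous_monodromy (hℓ : 0 ≤ ℓ) : Continuous (monodromy (𝕜 := 𝕜) q ℓ) := by
  have hsol (a b : 𝕜) : Continuous fun z => solution q z a b ℓ := continuous_iff_continuousAt.2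
    fun z => by
      have h (w : 𝕜) := isSolutionIVP_solution hq w a b
      exact tendsto_solution hq tendsto_id (fun w => (h w).toIsSolution) (h z).toIsSolution
        (fun w => (h w).init.trans (h z).init.symm)
        (fun w => (h w).init_deriv.trans (h z).init_deriv.symm) hℓ
  refine continuous_matrix fun i j => ?_
  have hu := hsol 1 0
  have hv := hsol 0 1
  fin_cases i <;> fin_cases j
  exacts [hu.fst, hv.fst, hu.snd, hv.snd]

end Monodromy

section Floquet

open Matrix

theorem mem_Ioo_of_forall_ne {f : ℝ → ℝ} {a b x : ℝ} (hf : ContinuousOn f (Icc a b))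
    (hx : x ∈ Ioo a b) (hlt : f a < f b) (hne : ∀ t ∈ Ioo a b, f t ≠ f a ∧ f t ≠ f b) :
    f x ∈ Ioo (f a) (f b) := by
  obtain ⟨hax, hxb⟩ := hx
  constructor
  · by_contra! hle
    obtain ⟨t, ht, hft⟩ := intermediate_value_Ioo hxb.le
      (hf.mono (Icc_subset_Icc_left hax.le)) ⟨hle.lt_of_ne (hne x ⟨hax, hxb⟩).1, hlt⟩
    exact (hne t (Ioo_subset_Ioo_left hax.le ht)).1 hft
  · by_contra! hge
    obtain ⟨t, ht, hft⟩ := intermediate_value_Ioo hax.le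
      (hf.mono (Icc_subset_Icc_right hxb.le)) ⟨hlt, hge.lt_of_ne' (hne x ⟨hax, hxb⟩).2⟩
    exact (hne t (Ioo_subset_Ioo_right hxb.le ht)).2 hft

theorem exists_mulVec_eq_smul_iff {K : Type*} [Field K] (M : Matrix (Fin 2) (Fin 2) K) (ρ : K) :
    (∃ v ≠ 0, M *ᵥ v = ρ • v) ↔ ρ ^ 2 - M.trace * ρ + M.det = 0 := by
  have hdet : (M - ρ • (1 : Matrix (Fin 2) (Fin 2) K)).det = ρ ^ 2 - M.trace * ρ + M.det := by
    simp only [one_fin_two, det_fin_two, trace_fin_two, Matrix.sub_apply, Matrix.smul_apply,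
      smul_eq_mul, of_apply, cons_val]
    ring
  simp only [← hdet, ← exists_mulVec_eq_zero_iff, sub_mulVec, smul_mulVec, one_mulVec, sub_eq_zero]

variable {𝕜 : Type*} [RCLike 𝕜] {q : ℝ → ℝ} {ℓ : ℝ} {z ρ : 𝕜} {y dy : ℝ → 𝕜}

/-- A Floquet solution: a nontrivial solution that is multiplied by `ρ` over the interval `[0, ℓ]`,
which is imposed on the initial values only. -/
structure IsFloquetSolution (q : ℝ → ℝ) (ℓ : ℝ) (z ρ : 𝕜) (y dy : ℝ → 𝕜) : Prop
    extends IsSolution q z y dy where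
  init_ne_zero : ![y 0, dy 0] ≠ 0
  multiplier : ![y ℓ, dy ℓ] = ρ • ![y 0, dy 0]

theorem IsFloquetSolution.apply_period (h : IsFloquetSolution q ℓ z ρ y dy) : y ℓ = ρ * y 0 :=
  congrFun h.multiplier 0

theorem IsFloquetSolution.deriv_apply_period (h : IsFloquetSolution q ℓ z ρ y dy) :
    dy ℓ = ρ * dy 0 :=
  congrFun h.multiplier 1

theorem IsSolution.exists_ne_zero (h : IsSolution q z y dy) (hℓ : 0 < ℓ)
    (hne : ![y 0, dy 0] ≠ 0) : ∃ x ∈ Icc 0 ℓ, y x ≠ 0 := by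
  by_contra! hzero
  have hy0 : y 0 = 0 := hzero 0 (left_mem_Icc.2 hℓ.le)
  have hdy0 : dy 0 = 0 := (uniqueDiffOn_Icc hℓ 0 (left_mem_Icc.2 hℓ.le)).eq_deriv _
    ((h.hasDeriv 0 le_rfl).mono Icc_subset_Ici_self)
    ((hasDerivWithinAt_const (0 : ℝ) (Icc 0 ℓ) (0 : 𝕜)).congr hzero hy0)
  simp [hy0, hdy0] at hne

variable (hq : ∀ a b, IntervalIntegrable q volume a b)
include hq

theorem IsFloquetSolution.apply_add_period (h : IsFloquetSolution q ℓ z ρ y dy) (hℓ : 0 ≤ ℓ)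
    (hper : q.Periodic ℓ) {x : ℝ} (hx : 0 ≤ x) : y (x + ℓ) = ρ * y x := by
  have hlinear := h.toIsSolution.linearCombination hq h.toIsSolution ρ 0
  simpa using ((h.toIsSolution.comp_add_right hq hℓ hper).eq_of_init_eq hq hlinear
    (by simpa using h.apply_period) (by simpa using h.deriv_apply_period) hx).1

theorem exists_isFloquetSolution_iff (hℓ : 0 ≤ ℓ) :
    (∃ y dy, IsFloquetSolution q ℓ z ρ y dy) ↔
      ρ ^ 2 - (monodromy q ℓ z).trace * ρ + 1 = 0 := by
  rw [← det_monodromy hq hℓ z, ← exists_mulVec_eq_smul_iff]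
  constructor
  · rintro ⟨y, dy, h⟩
    exact ⟨_, h.init_ne_zero, (h.toIsSolution.monodromy_mulVec hq hℓ).trans h.multiplier⟩
  · rintro ⟨v, hv, hMv⟩
    have h := isSolutionIVP_solution hq z (v 0) (v 1)
    have hinit : ![(solution q z (v 0) (v 1) 0).1, (solution q z (v 0) (v 1) 0).2] = v := by
      rw [h.init, h.init_deriv, ← List.ofFn_inj]
      simp
    exact ⟨_, _, h.toIsSolution, by rwa [hinit], by
      rw [hinit, ← hMv, ← h.toIsSolution.monodromy_mulVec hq hℓ, hinit]⟩

theorem isEigenvalue_iff_trace_monodromy (hℓ : 0 < ℓ) {s lam : ℝ} (hs : s ^ 2 = 1) :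
    IsEigenvalue q ℓ s lam ↔ (monodromy q ℓ lam).trace = 2 * s := by
  have hfloquet : IsEigenvalue q ℓ s lam ↔ ∃ y dy, IsFloquetSolution q ℓ lam s y dy := by
    refine exists₂_congr fun y dy => ⟨?_, ?_⟩
    · rintro ⟨h, ⟨x, hx, hne⟩, hy, hdy⟩
      refine ⟨h, fun h0 => hne ?_, ?_⟩
      · simp only [cons_eq_zero_iff] at h0
        simpa using (h.eq_of_init_eq hq (h.linearCombination hq h 0 0) (by simp [h0])
          (by simp [h0]) hx.1).1
      · rw [hy, hdy, smul_cons, smul_cons, smul_eq_mul, smul_eq_mul, ← mul_assoc, ← mul_assoc,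
          ← sq, hs, one_mul, one_mul, Matrix.smul_empty]
    · intro h
      exact ⟨h.toIsSolution, h.toIsSolution.exists_ne_zero hℓ h.init_ne_zero,
        by rw [h.apply_period]; linear_combination (-y 0) * hs,
        by rw [h.deriv_apply_period]; linear_combination (-dy 0) * hs⟩
  rw [hfloquet, exists_isFloquetSolution_iff hq hℓ.le]
  constructor <;> intro h
  · linear_combination (-s) * h + (s - (monodromy q ℓ lam).trace) * hs
  · rw [h]
    linear_combination -hs

theorem IsStabilityInterval.trace_monodromy_sq_lt (hℓ : 0 < ℓ) {a b lam : ℝ}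
    (h : IsStabilityInterval q ℓ a b) (hlam : lam ∈ Ioo a b) :
    (monodromy q ℓ lam).trace ^ 2 < 4 := by
  set D : ℝ → ℝ := fun t => (monodromy q ℓ t).trace
  have hD : Continuous D := (continuous_monodromy hq hℓ.le).matrix_trace
  have hper (t : ℝ) : IsPeriodicEigenvalue q ℓ t ↔ D t = 2 := by
    rw [IsPeriodicEigenvalue, isEigenvalue_iff_trace_monodromy hq hℓ (one_pow 2), mul_one]
  have hsemi (t : ℝ) : IsSemiperiodicEigenvalue q ℓ t ↔ D t = -2 := by
    rw [IsSemiperiodicEigenvalue, isEigenvalue_iff_trace_monodromy hq hℓ neg_one_sq, mul_neg_one]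
  obtain ⟨-, hends, hne⟩ := h
  simp only [hper, hsemi] at hends hne
  suffices D lam ∈ Ioo (-2) 2 by nlinarith [this.1, this.2]
  rcases hends with ⟨ha, hb⟩ | ⟨ha, hb⟩
  · have hneg := mem_Ioo_of_forall_ne hD.neg.continuousOn hlam (by simp [ha, hb])
      fun t ht => by simpa [ha, hb, neg_eq_iff_eq_neg] using hne t ht
    simpa [ha, hb, neg_lt, and_comm] using hneg
  · have hpos := mem_Ioo_of_forall_ne hD.continuousOn hlam (by simp [ha, hb])
      fun t ht => by simpa [ha, hb] using (hne t ht).symm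
    simpa [ha, hb] using hpos

end Floquet

section SquareIntegrable

open scoped ENNReal

theorem lintegral_Ioi_zero_of_add_period {f : ℝ → ℝ≥0∞} {c : ℝ≥0∞} {ℓ : ℝ} (hℓ : 0 < ℓ)
    (hc : c ≠ ∞) (hf : ∀ x, 0 < x → f (x + ℓ) = c * f x) :
    ∫⁻ x in Ioi 0, f x = (1 - c)⁻¹ * ∫⁻ x in Ioc 0 ℓ, f x := by
  have hiter (n : ℕ) (x : ℝ) (hx : 0 < x) : f (x + n * ℓ) = c ^ n * f x := by
    induction n with
    | zero => simp
    | succ n ih =>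
      rw [Nat.cast_succ, add_one_mul, ← add_assoc, hf _ (by positivity), ih, pow_succ', mul_assoc]
  have hpiece (n : ℕ) : ∫⁻ x in Ioc (n * ℓ) ((n + 1 : ℕ) * ℓ), f x =
      c ^ n * ∫⁻ x in Ioc 0 ℓ, f x := by
    have htranslate := (measurePreserving_add_right volume (n * ℓ)).setLIntegral_comp_preimage_emb
      (measurableEmbedding_addRight (n * ℓ)) f (Ioc (n * ℓ) ((n + 1 : ℕ) * ℓ))
    have hpreimage : (· + n * ℓ) ⁻¹' Ioc (n * ℓ) ((n + 1 : ℕ) * ℓ) = Ioc 0 ℓ := by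
      rw [preimage_add_const_Ioc, sub_self, Nat.cast_succ, add_one_mul, add_sub_cancel_left]
    rw [← htranslate, hpreimage, setLIntegral_congr_fun measurableSet_Ioc
      fun x hx => hiter n x hx.1, lintegral_const_mul' _ _ (ENNReal.pow_ne_top hc)]
  have hmono : Monotone fun n : ℕ => n * ℓ := fun m n hmn => by
    have : (m : ℝ) ≤ n := Nat.cast_le.2 hmn
    dsimp only
    gcongr
  have hunbounded : ¬ BddAbove (range fun n : ℕ => n * ℓ) :=
    not_bddAbove_of_tendsto_atTop (tendsto_natCast_atTop_atTop.atTop_mul_const hℓ)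
  have hunion : ⋃ n : ℕ, Ioc (n * ℓ) ((n + 1 : ℕ) * ℓ) = Ioi 0 := by
    simpa using iUnion_Ioc_map_succ_eq_Ioi (fun n => hmono (Nat.zero_le n)) hunbounded
  have hdisjoint : Pairwise (Function.onFun Disjoint fun n : ℕ => Ioc (n * ℓ) ((n + 1 : ℕ) * ℓ)) :=
    hmono.pairwise_disjoint_on_Ioc_succ
  rw [← hunion, lintegral_iUnion (fun _ => measurableSet_Ioc) hdisjoint]
  simp only [hpiece, ENNReal.tsum_mul_right, ENNReal.tsum_geometric]

variable {𝕜 : Type*} [RCLike 𝕜] {q : ℝ → ℝ} {ℓ : ℝ} {z ρ : 𝕜} {y dy : ℝ → 𝕜}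

theorem IsFloquetSolution.integral_norm_sq_pos (h : IsFloquetSolution q ℓ z ρ y dy) (hℓ : 0 < ℓ) :
    0 < ∫ t in (0 : ℝ)..ℓ, ‖y t‖ ^ 2 := by
  obtain ⟨x, hx, hyx⟩ := h.toIsSolution.exists_ne_zero hℓ h.init_ne_zero
  exact intervalIntegral.integral_pos hℓ
    ((h.continuousOn.mono Icc_subset_Ici_self).norm.pow 2) (fun t _ => sq_nonneg ‖y t‖)
    ⟨x, hx, by positivity⟩

theorem IsSolution.aestronglyMeasurable (h : IsSolution q z y dy) :
    AEStronglyMeasurable y (volume.restrict (Ioi 0)) :=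
  (h.continuousOn.mono Ioi_subset_Ici_self).aestronglyMeasurable measurableSet_Ioi

theorem IsFloquetSolution.memLp_two_iff (h : IsFloquetSolution q ℓ z ρ y dy)
    (hq : ∀ a b, IntervalIntegrable q volume a b) (hℓ : 0 < ℓ) (hper : q.Periodic ℓ) :
    MemLp y 2 (volume.restrict (Ioi 0)) ↔ ‖ρ‖ < 1 := by
  have hshift (x : ℝ) (hx : 0 < x) : ‖y (x + ℓ)‖ₑ ^ 2 = ‖ρ‖ₑ ^ 2 * ‖y x‖ₑ ^ 2 := by
    rw [h.apply_add_period hq hℓ.le hper hx.le, enorm_mul, mul_pow]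
  have hperiod : ∫⁻ x in Ioc 0 ℓ, ‖y x‖ₑ ^ 2 = ENNReal.ofReal (∫ t in (0 : ℝ)..ℓ, ‖y t‖ ^ 2) := by
    have hint : IntegrableOn (fun t => ‖y t‖ ^ 2) (Ioc 0 ℓ) :=
      (((h.continuousOn.mono Icc_subset_Ici_self).norm.pow 2).integrableOn_Icc).mono_set
        Ioc_subset_Icc_self
    rw [intervalIntegral.integral_of_le hℓ.le,
      ofReal_integral_eq_lintegral_ofReal hint (ae_of_all _ fun t => sq_nonneg _)]
    simp only [← ofReal_norm, ENNReal.ofReal_pow (norm_nonneg _)]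
  have hpos : ENNReal.ofReal (∫ t in (0 : ℝ)..ℓ, ‖y t‖ ^ 2) ≠ 0 :=
    (ENNReal.ofReal_pos.2 (h.integral_norm_sq_pos hℓ)).ne'
  calc MemLp y 2 (volume.restrict (Ioi 0)) ↔ ∫⁻ x in Ioi 0, ‖y x‖ₑ ^ 2 < ∞ := by
        rw [MemLp, and_iff_right h.toIsSolution.aestronglyMeasurable,
          eLpNorm_lt_top_iff_lintegral_rpow_enorm_lt_top two_ne_zero ENNReal.ofNat_ne_top]
        simp
    _ ↔ (1 - ‖ρ‖ₑ ^ 2)⁻¹ * ENNReal.ofReal (∫ t in (0 : ℝ)..ℓ, ‖y t‖ ^ 2) < ∞ := by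
        rw [lintegral_Ioi_zero_of_add_period hℓ (ENNReal.pow_ne_top enorm_ne_top) hshift, hperiod]
    _ ↔ ‖ρ‖ₑ ^ 2 < 1 := by
        rw [ENNReal.mul_lt_top_iff]
        simp [hpos, ENNReal.inv_lt_top]
    _ ↔ ‖ρ‖ < 1 := by
        rw [pow_lt_one_iff two_ne_zero, ← ofReal_norm, ENNReal.ofReal_lt_one]

end SquareIntegrable

section SquareIntegrableSolutions

open scoped ComplexConjugate

variable {q : ℝ → ℝ} {ℓ : ℝ} {z ρ : ℂ} {y dy : ℝ → ℂ}
variable (hq : ∀ a b, IntervalIntegrable q volume a b)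
include hq

theorem IsFloquetSolution.im_mul_integral_norm_sq (h : IsFloquetSolution q ℓ z ρ y dy)
    (hℓ : 0 ≤ ℓ) :
    z.im * ∫ t in (0 : ℝ)..ℓ, ‖y t‖ ^ 2 = (1 - ‖ρ‖ ^ 2) * (conj (y 0) * dy 0).im := by
  have hend : conj (y ℓ) * dy ℓ = ((‖ρ‖ ^ 2 : ℝ) : ℂ) * (conj (y 0) * dy 0) := by
    rw [h.apply_period, h.deriv_apply_period, map_mul, Complex.ofReal_pow, ← Complex.conj_mul']
    ring
  rw [h.toIsSolution.im_mul_integral_norm_sq hq hℓ, hend, Complex.im_ofReal_mul]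
  ring

theorem IsFloquetSolution.one_sub_norm_sq_mul_im_ne_zero (h : IsFloquetSolution q ℓ z ρ y dy)
    (hℓ : 0 < ℓ) (hz : z.im ≠ 0) : (1 - ‖ρ‖ ^ 2) * (conj (y 0) * dy 0).im ≠ 0 := by
  rw [← h.im_mul_integral_norm_sq hq hℓ.le]
  exact mul_ne_zero hz (h.integral_norm_sq_pos hℓ).ne'

theorem exists_isFloquetSolution_norm_lt_one (hℓ : 0 < ℓ) (hz : z.im ≠ 0) :
    ∃ ρ : ℂ, 0 < ‖ρ‖ ∧ ‖ρ‖ < 1 ∧ (∃ y dy, IsFloquetSolution q ℓ z ρ y dy) ∧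
      ∃ y dy, IsFloquetSolution q ℓ z ρ⁻¹ y dy := by
  simp only [exists_isFloquetSolution_iff hq hℓ.le]
  obtain ⟨s, hs⟩ := IsAlgClosed.exists_pow_nat_eq ((monodromy q ℓ z).trace ^ 2 - 4) two_pos
  obtain ⟨ρ, hρ⟩ : ∃ ρ : ℂ, ρ ^ 2 - (monodromy q ℓ z).trace * ρ + 1 = 0 :=
    ⟨((monodromy q ℓ z).trace + s) / 2, by linear_combination hs / 4⟩
  have hρ0 : ρ ≠ 0 := by
    rintro rfl
    simp at hρ
  have hinv : ρ⁻¹ ^ 2 - (monodromy q ℓ z).trace * ρ⁻¹ + 1 = 0 := by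
    field_simp
    linear_combination hρ
  obtain ⟨y, dy, hy⟩ := (exists_isFloquetSolution_iff hq hℓ.le).2 hρ
  have hρ1 : ‖ρ‖ ≠ 1 := fun h =>
    left_ne_zero_of_mul (hy.one_sub_norm_sq_mul_im_ne_zero hq hℓ hz) (by rw [h]; norm_num)
  rcases hρ1.lt_or_gt with hlt | hgt
  · exact ⟨ρ, norm_pos_iff.2 hρ0, hlt, hρ, hinv⟩
  · exact ⟨ρ⁻¹, norm_pos_iff.2 (inv_ne_zero hρ0), by rw [norm_inv]; exact inv_lt_one_of_one_lt₀ hgt,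
      hinv, by rwa [inv_inv]⟩

-- If the Wronskian did not vanish, every solution would be square integrable, including the
-- Floquet solution with multiplier outside the unit disc.
theorem IsSolution.wronskian_eq_zero_of_memLp (hℓ : 0 < ℓ) (hper : q.Periodic ℓ) (hz : z.im ≠ 0)
    {y₁ dy₁ y₂ dy₂ : ℝ → ℂ} (h₁ : IsSolution q z y₁ dy₁) (h₂ : IsSolution q z y₂ dy₂)
    (hL₁ : MemLp y₁ 2 (volume.restrict (Ioi 0))) (hL₂ : MemLp y₂ 2 (volume.restrict (Ioi 0))) :
    wronskian y₁ dy₁ y₂ dy₂ 0 = 0 := by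
  by_contra hW
  obtain ⟨ρ, hρ0, hρ1, -, w, dw, hw⟩ := exists_isFloquetSolution_norm_lt_one hq hℓ hz
  set c := wronskian w dw y₂ dy₂ 0 / wronskian y₁ dy₁ y₂ dy₂ 0 with hc
  set d := wronskian y₁ dy₁ w dw 0 / wronskian y₁ dy₁ y₂ dy₂ 0 with hd
  have hcomb (x : ℝ) (hx : 0 ≤ x) : c * y₁ x + d * y₂ x = w x :=
    ((h₁.linearCombination hq h₂ c d).eq_of_init_eq hq hw.toIsSolution
      (by rw [hc, hd]; field_simp; simp only [wronskian]; ring)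
      (by rw [hc, hd]; field_simp; simp only [wronskian]; ring) hx).1
  have hL : MemLp w 2 (volume.restrict (Ioi 0)) :=
    ((hL₁.const_mul c).add (hL₂.const_mul d)).ae_eq
      ((ae_restrict_mem measurableSet_Ioi).mono fun x hx => hcomb x (mem_Ioi.1 hx).le)
  rw [hw.memLp_two_iff hq hℓ hper, norm_inv] at hL
  exact lt_asymm hL ((one_lt_inv₀ hρ0).2 hρ1)

theorem IsSolution.exists_isFloquetSolution_of_memLp (hℓ : 0 < ℓ) (hper : q.Periodic ℓ)
    (hz : z.im ≠ 0) (h : IsSolution q z y dy) (hL : MemLp y 2 (volume.restrict (Ioi 0)))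
    (hne : ![y 0, dy 0] ≠ 0) : ∃ ρ : ℂ, ‖ρ‖ < 1 ∧ IsFloquetSolution q ℓ z ρ y dy := by
  have hLshift : MemLp (fun x => y (x + ℓ)) 2 (volume.restrict (Ioi 0)) := by
    have hpreserving := (measurePreserving_add_right volume ℓ).restrict_preimage
      (measurableSet_Ioi (a := ℓ))
    rw [preimage_add_const_Ioi, sub_self] at hpreserving
    have hLtail : MemLp y 2 (volume.restrict (Ioi ℓ)) :=
      hL.mono_measure (Measure.restrict_mono_set volume (Ioi_subset_Ioi hℓ.le))
    exact hLtail.comp_measurePreserving hpreserving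
  have hW := h.wronskian_eq_zero_of_memLp hq hℓ hper hz (h.comp_add_right hq hℓ.le hper) hL hLshift
  simp only [wronskian, zero_add] at hW
  obtain ⟨ρ, hρ⟩ : ∃ ρ : ℂ, ![y ℓ, dy ℓ] = ρ • ![y 0, dy 0] := by
    by_cases hy0 : y 0 = 0
    · have hdy0 : dy 0 ≠ 0 := fun hdy0 => hne (by simp [hy0, hdy0])
      refine ⟨dy ℓ / dy 0, ?_⟩
      have hyℓ : y ℓ = 0 := by simpa [hy0, hdy0] using hW
      simp [hy0, hyℓ, hdy0]
    · refine ⟨y ℓ / y 0, ?_⟩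
      have hdyℓ : dy ℓ = y ℓ / y 0 * dy 0 := by
        field_simp
        linear_combination hW
      simp [hy0, ← hdyℓ]
  have hfloquet : IsFloquetSolution q ℓ z ρ y dy := ⟨h, hne, hρ⟩
  exact ⟨ρ, (hfloquet.memLp_two_iff hq hℓ hper).1 hL, hfloquet⟩

end SquareIntegrableSolutions

section TitchmarshWeyl

open scoped ComplexConjugate

variable {q : ℝ → ℝ} {ℓ α : ℝ} {z m : ℂ} {ψ dψ : ℝ → ℂ}

/-- The Weyl solution `ψ = θ + m φ`: the square integrable solution whose initial values are those
of `θ + m φ`. -/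
structure IsWeylSolution (q : ℝ → ℝ) (α : ℝ) (z m : ℂ) (ψ dψ : ℝ → ℂ) : Prop
    extends IsSolutionIVP q z (Real.cos α - m * Real.sin α) (Real.sin α + m * Real.cos α) ψ dψ where
  memLp : MemLp ψ 2 (volume.restrict (Ioi 0))

theorem ofReal_cos_sq_add_sin_sq (α : ℝ) : (Real.cos α : ℂ) ^ 2 + (Real.sin α : ℂ) ^ 2 = 1 :=
  mod_cast Real.cos_sq_add_sin_sq α

theorem IsWeylSolution.init_ne_zero (h : IsWeylSolution q α z m ψ dψ) : ![ψ 0, dψ 0] ≠ 0 := by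
  intro h0
  simp only [Matrix.cons_eq_zero_iff, h.init, h.init_deriv] at h0
  refine one_ne_zero (α := ℂ) ?_
  linear_combination (Real.cos α : ℂ) * h0.1 + (Real.sin α : ℂ) * h0.2.1 -
    ofReal_cos_sq_add_sin_sq α

theorem IsWeylSolution.im_conj_mul (h : IsWeylSolution q α z m ψ dψ) :
    (conj (ψ 0) * dψ 0).im = m.im := by
  rw [h.init, h.init_deriv]
  simp only [map_sub, map_mul, Complex.conj_ofReal, Complex.mul_im, Complex.sub_re, Complex.sub_im,
    Complex.add_re, Complex.add_im, Complex.mul_re, Complex.ofReal_re, Complex.ofReal_im,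
    Complex.conj_re, Complex.conj_im]
  linear_combination m.im * Real.cos_sq_add_sin_sq α

variable (hq : ∀ a b, IntervalIntegrable q volume a b)
include hq

theorem isTitchmarshWeyl_iff_exists_isWeylSolution :
    IsTitchmarshWeyl q α z m ↔ ∃ ψ dψ, IsWeylSolution q α z m ψ dψ := by
  constructor
  · rintro ⟨θ, dθ, φ, dφ, hθ, hφ, hL⟩
    refine ⟨_, _, ⟨hθ.toIsSolution.linearCombination hq hφ.toIsSolution 1 m, ?_, ?_⟩, ?_⟩
    · rw [hθ.init, hφ.init]
      ring
    · rw [hθ.init_deriv, hφ.init_deriv]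
      ring
    · simpa using hL
  · rintro ⟨ψ, dψ, hψ⟩
    have hθ := isSolutionIVP_solution hq z (Real.cos α : ℂ) (Real.sin α : ℂ)
    have hφ := isSolutionIVP_solution hq z (-(Real.sin α : ℂ)) (Real.cos α : ℂ)
    have hcomb := hθ.toIsSolution.linearCombination hq hφ.toIsSolution 1 m
    refine ⟨_, _, _, _, hθ, hφ, hψ.memLp.ae_eq
      ((ae_restrict_mem measurableSet_Ioi).mono fun x hx => ?_)⟩
    have heq := (hψ.toIsSolution.eq_of_init_eq hq hcomb
      (by rw [hψ.init, hθ.init, hφ.init]; ring)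
      (by rw [hψ.init_deriv, hθ.init_deriv, hφ.init_deriv]; ring) (mem_Ioi.1 hx).le).1
    rwa [one_mul] at heq

variable (hℓ : 0 < ℓ) (hper : q.Periodic ℓ) (hz : z.im ≠ 0)
include hℓ hper hz

theorem IsWeylSolution.exists_isFloquetSolution (h : IsWeylSolution q α z m ψ dψ) :
    ∃ ρ : ℂ, ‖ρ‖ < 1 ∧ IsFloquetSolution q ℓ z ρ ψ dψ :=
  h.toIsSolution.exists_isFloquetSolution_of_memLp hq hℓ hper hz h.memLp h.init_ne_zero

theorem IsWeylSolution.im_mul_im_pos (h : IsWeylSolution q α z m ψ dψ) : 0 < z.im * m.im := by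
  obtain ⟨ρ, hρ, hfloquet⟩ := h.exists_isFloquetSolution hq hℓ hper hz
  have hgreen := hfloquet.im_mul_integral_norm_sq hq hℓ.le
  rw [h.im_conj_mul] at hgreen
  have hρsq : 0 < 1 - ‖ρ‖ ^ 2 := sub_pos.2 (pow_lt_one₀ (norm_nonneg ρ) hρ two_ne_zero)
  have hpos : 0 < (1 - ‖ρ‖ ^ 2) * (z.im * m.im) :=
    calc 0 < z.im ^ 2 * ∫ t in (0 : ℝ)..ℓ, ‖ψ t‖ ^ 2 :=
          mul_pos (by positivity) (hfloquet.integral_norm_sq_pos hℓ)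
      _ = (1 - ‖ρ‖ ^ 2) * (z.im * m.im) := by linear_combination z.im * hgreen
  exact pos_of_mul_pos_right hpos hρsq.le

theorem IsWeylSolution.unique {m' : ℂ} {ψ' dψ' : ℝ → ℂ} (h : IsWeylSolution q α z m ψ dψ)
    (h' : IsWeylSolution q α z m' ψ' dψ') : m = m' := by
  have hW := h.toIsSolution.wronskian_eq_zero_of_memLp hq hℓ hper hz h'.toIsSolution h.memLp
    h'.memLp
  rw [wronskian, h.init, h.init_deriv, h'.init, h'.init_deriv] at hW
  linear_combination -hW + (m' - m) * ofReal_cos_sq_add_sin_sq α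

theorem exists_isWeylSolution (α : ℝ) : ∃ m ψ dψ, IsWeylSolution q α z m ψ dψ := by
  obtain ⟨ρ, -, hρ, ⟨y, dy, hy⟩, -⟩ := exists_isFloquetSolution_norm_lt_one hq hℓ hz
  set k : ℂ := y 0 * Real.cos α + dy 0 * Real.sin α with hk
  set t : ℂ := dy 0 * Real.cos α - y 0 * Real.sin α with ht
  have hcs := ofReal_cos_sq_add_sin_sq α
  have hy0 : y 0 = k * Real.cos α - t * Real.sin α := by
    rw [hk, ht]
    linear_combination (-y 0) * hcs
  have hdy0 : dy 0 = k * Real.sin α + t * Real.cos α := by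
    rw [hk, ht]
    linear_combination (-dy 0) * hcs
  have hk0 : k ≠ 0 := by
    intro hk0
    apply right_ne_zero_of_mul (hy.one_sub_norm_sq_mul_im_ne_zero hq hℓ hz)
    have hreal : conj (y 0) * dy 0 = ((-Complex.normSq t * Real.sin α * Real.cos α : ℝ) : ℂ) := by
      rw [hy0, hdy0, hk0]
      simp only [Complex.ofReal_mul, Complex.ofReal_neg, Complex.normSq_eq_conj_mul_self, map_sub,
        map_mul, zero_mul, map_zero, Complex.conj_ofReal]
      ring
    rw [hreal, Complex.ofReal_im]
  have hψ := hy.toIsSolution.linearCombination hq hy.toIsSolution k⁻¹ 0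
  simp only [zero_mul, add_zero] at hψ
  refine ⟨t / k, _, _, ⟨hψ, ?_, ?_⟩, ((hy.memLp_two_iff hq hℓ hper).2 hρ).const_mul k⁻¹⟩
  · rw [hy0]
    field_simp
  · rw [hdy0]
    field_simp

theorem existsUnique_isTitchmarshWeyl (α : ℝ) : ∃! m : ℂ, IsTitchmarshWeyl q α z m := by
  simp only [isTitchmarshWeyl_iff_exists_isWeylSolution hq]
  obtain ⟨m, ψ, dψ, h⟩ := exists_isWeylSolution hq hℓ hper hz α
  exact ⟨m, ⟨ψ, dψ, h⟩, fun _ ⟨_, _, h'⟩ => h'.unique hq hℓ hper hz h⟩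

theorem exists_isWeylSolution_titchmarshWeylM (α : ℝ) :
    ∃ ψ dψ, IsWeylSolution q α z (titchmarshWeylM q α z) ψ dψ := by
  have hex := (existsUnique_isTitchmarshWeyl hq hℓ hper hz α).exists
  rw [← isTitchmarshWeyl_iff_exists_isWeylSolution hq, titchmarshWeylM, dif_pos hex]
  exact hex.choose_spec

end TitchmarshWeyl

section RotationConj

open Matrix

variable {A : Type*} [CommRing A] {c s : A}

/-- The matrix `M` in the basis `(c, s)`, `(-s, c)`. For `c = cos α`, `s = sin α` and a monodromy
matrix `M`, these basis vectors are the initial values of `θ` and `φ`. -/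
def rotationConj (c s : A) (M : Matrix (Fin 2) (Fin 2) A) : Matrix (Fin 2) (Fin 2) A :=
  !![c, s; -s, c] * M * !![c, -s; s, c]

theorem rotationConj_apply_zero_one (c s : A) (M : Matrix (Fin 2) (Fin 2) A) :
    rotationConj c s M 0 1 = -(M 1 0 * s ^ 2 + (M 0 0 - M 1 1) * c * s - M 0 1 * c ^ 2) := by
  simp only [rotationConj, mul_apply, Fin.sum_univ_two, of_apply, cons_val]
  ring

theorem rotationConj_map {B : Type*} [CommRing B] (σ : A →+* B) (c s : A)
    (M : Matrix (Fin 2) (Fin 2) A) :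
    rotationConj (σ c) (σ s) (M.map σ) = (rotationConj c s M).map σ := by
  have hrotation (a b : A) : !![σ a, σ b; -σ b, σ a] = !![a, b; -b, a].map σ := by
    ext i j
    fin_cases i <;> fin_cases j <;> simp
  have hrotation_neg := hrotation c (-s)
  rw [map_neg, neg_neg, neg_neg] at hrotation_neg
  rw [rotationConj, rotationConj, hrotation, hrotation_neg, Matrix.map_mul, Matrix.map_mul]

theorem rotation_mul_rotation_neg (h : c ^ 2 + s ^ 2 = 1) :
    !![c, -s; s, c] * !![c, s; -s, c] = 1 := by
  have hcs : c * c + s * s = 1 := by linear_combination h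
  simp [one_fin_two, hcs, add_comm (s * s), mul_comm s c]

theorem trace_rotationConj (h : c ^ 2 + s ^ 2 = 1) (M : Matrix (Fin 2) (Fin 2) A) :
    (rotationConj c s M).trace = M.trace := by
  rw [rotationConj, mul_assoc, trace_mul_comm, mul_assoc, rotation_mul_rotation_neg h, mul_one]

theorem det_rotationConj (h : c ^ 2 + s ^ 2 = 1) (M : Matrix (Fin 2) (Fin 2) A) :
    (rotationConj c s M).det = M.det := by
  rw [rotationConj, mul_assoc, det_mul_comm, mul_assoc, rotation_mul_rotation_neg h, mul_one]

theorem rotationConj_mulVec (h : c ^ 2 + s ^ 2 = 1) {M : Matrix (Fin 2) (Fin 2) A} {ρ m : A}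
    (hM : M *ᵥ ![c - m * s, s + m * c] = ρ • ![c - m * s, s + m * c]) :
    rotationConj c s M *ᵥ ![1, m] = ρ • ![1, m] := by
  have hvec : ![c - m * s, s + m * c] = !![c, -s; s, c] *ᵥ ![1, m] := by
    ext i
    fin_cases i <;> simp [sub_eq_add_neg, mul_comm]
  rw [hvec] at hM
  rw [rotationConj, mul_assoc, ← mulVec_mulVec, ← mulVec_mulVec, hM, mulVec_smul, mulVec_mulVec,
    mul_eq_one_comm.1 (rotation_mul_rotation_neg h), one_mulVec]

theorem quadratic_of_mulVec_eq_smul {N : Matrix (Fin 2) (Fin 2) A} {ρ m : A}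
    (hN : N *ᵥ ![1, m] = ρ • ![1, m]) :
    N 0 1 * m ^ 2 + (N 0 0 - N 1 1) * m + -N 1 0 = 0 := by
  have h₀ := congrFun hN 0
  have h₁ := congrFun hN 1
  simp only [mulVec, dotProduct, Fin.sum_univ_two, Pi.smul_apply, smul_eq_mul, cons_val] at h₀ h₁
  linear_combination m * h₀ - h₁

theorem trace_sq_sub_four_mul_det (N : Matrix (Fin 2) (Fin 2) A) :
    N.trace ^ 2 - 4 * N.det = (N 0 0 - N 1 1) ^ 2 - 4 * N 0 1 * -N 1 0 := by
  rw [trace_fin_two, det_fin_two]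
  ring

end RotationConj

section QuadraticRoots

variable {ι : Type*} {l : Filter ι}

theorem add_div_two_mul_sq_of_quadratic {F : Type*} [Field F] [NeZero (2 : F)] {a b c m : F}
    (ha : a ≠ 0) (h : a * m ^ 2 + b * m + c = 0) :
    (m + b / (2 * a)) ^ 2 = (b ^ 2 - 4 * a * c) / (2 * a) ^ 2 := by
  have h2 : (2 : F) ≠ 0 := two_ne_zero
  field_simp
  linear_combination 4 * a * h

theorem tendsto_im_of_tendsto_sq {w : ι → ℂ} {K : ℝ} (hK : 0 < K)
    (hw : Tendsto (fun i => w i ^ 2) l (𝓝 (-(K : ℂ) ^ 2)))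
    (him : ∀ᶠ i in l, -(K / 2) ≤ (w i).im) : Tendsto (fun i => (w i).im) l (𝓝 K) := by
  have hlim : Tendsto (fun i => ‖w i ^ 2 - -(K : ℂ) ^ 2‖ / (K / 2)) l (𝓝 0) := by
    simpa using (tendsto_iff_norm_sub_tendsto_zero.1 hw).div_const (K / 2)
  refine tendsto_iff_norm_sub_tendsto_zero.2
    (squeeze_zero' (.of_forall fun _ => norm_nonneg _) ?_ hlim)
  filter_upwards [him] with i hi
  have hfactor : w i ^ 2 - -(K : ℂ) ^ 2 = (w i - K * Complex.I) * (w i + K * Complex.I) := by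
    linear_combination (K : ℂ) ^ 2 * Complex.I_sq
  have hplus : K / 2 ≤ ‖w i + K * Complex.I‖ :=
    calc K / 2 ≤ (w i + K * Complex.I).im := by
          rw [Complex.add_im, Complex.im_ofReal_mul, Complex.I_im]
          linarith
      _ ≤ ‖w i + K * Complex.I‖ := Complex.im_le_norm _
  have hminus : ‖(w i).im - K‖ ≤ ‖w i - K * Complex.I‖ := by
    simpa using Complex.abs_im_le_norm (w i - K * Complex.I)
  rw [hfactor, norm_mul, le_div_iff₀ (half_pos hK)]
  gcongr

theorem tendsto_im_of_quadratic {a b c m : ι → ℂ} {a₀ b₀ c₀ : ℝ} (ha : Tendsto a l (𝓝 a₀))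
    (hb : Tendsto b l (𝓝 b₀)) (hc : Tendsto c l (𝓝 c₀)) (hdiscrim : b₀ ^ 2 - 4 * a₀ * c₀ < 0)
    (hm : ∀ᶠ i in l, a i * m i ^ 2 + b i * m i + c i = 0) (him : ∀ᶠ i in l, 0 ≤ (m i).im) :
    Tendsto (fun i => (m i).im) l (𝓝 (√(4 * a₀ * c₀ - b₀ ^ 2) / (2 * |a₀|))) := by
  have ha₀ : a₀ ≠ 0 := by
    rintro rfl
    nlinarith [sq_nonneg b₀]
  set K : ℝ := √(4 * a₀ * c₀ - b₀ ^ 2) / (2 * |a₀|) with hK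
  have hdiscrim' : 0 < 4 * a₀ * c₀ - b₀ ^ 2 := by linarith
  have hKpos : 0 < K := div_pos (Real.sqrt_pos.2 hdiscrim') (by positivity)
  have hKsq : (b₀ ^ 2 - 4 * a₀ * c₀) / (2 * a₀) ^ 2 = -K ^ 2 := by
    rw [hK, div_pow, Real.sq_sqrt hdiscrim'.le, mul_pow, mul_pow, sq_abs]
    ring
  have h2a₀ : (2 * a₀ : ℂ) ≠ 0 := by exact_mod_cast mul_ne_zero two_ne_zero ha₀
  have h2a : Tendsto (fun i => 2 * a i) l (𝓝 (2 * a₀)) := ha.const_mul 2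
  have hvertex : Tendsto (fun i => (b i / (2 * a i)).im) l (𝓝 0) := by
    have := (Complex.continuous_im.tendsto _).comp (hb.div h2a h2a₀)
    rwa [show (b₀ / (2 * a₀) : ℂ) = ((b₀ / (2 * a₀) : ℝ) : ℂ) by push_cast; rfl,
      Complex.ofReal_im] at this
  have hsq : Tendsto (fun i => (m i + b i / (2 * a i)) ^ 2) l (𝓝 (-(K : ℂ) ^ 2)) := by
    have hlim : Tendsto (fun i => (b i ^ 2 - 4 * a i * c i) / (2 * a i) ^ 2) l
        (𝓝 (-(K : ℂ) ^ 2)) := by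
      have hvalue : ((b₀ : ℂ) ^ 2 - 4 * a₀ * c₀) / (2 * a₀) ^ 2 = -(K : ℂ) ^ 2 := mod_cast hKsq
      rw [← hvalue]
      exact ((hb.pow 2).sub ((ha.const_mul 4).mul hc)).div (h2a.pow 2) (pow_ne_zero 2 h2a₀)
    refine hlim.congr' ?_
    filter_upwards [hm, h2a.eventually_ne h2a₀] with i hi hai
    exact (add_div_two_mul_sq_of_quadratic (right_ne_zero_of_mul hai) hi).symm
  have him' : ∀ᶠ i in l, -(K / 2) ≤ (m i + b i / (2 * a i)).im := by
    filter_upwards [him, hvertex.eventually_const_lt (neg_lt_zero.2 (half_pos hKpos))]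
      with i hmi hbi
    rw [Complex.add_im]
    linarith
  simpa using (tendsto_im_of_tendsto_sq hKpos hsq him').sub hvertex

end QuadraticRoots

section SpectralDensity

open Matrix

variable {q : ℝ → ℝ} {ℓ α lam : ℝ}

theorem IsWeylSolution.exists_rotationConj_mulVec_eq_smul {z m : ℂ} {ψ dψ : ℝ → ℂ}
    (h : IsWeylSolution q α z m ψ dψ) (hq : ∀ a b, IntervalIntegrable q volume a b) (hℓ : 0 < ℓ)
    (hper : q.Periodic ℓ) (hz : z.im ≠ 0) :
    ∃ ρ : ℂ, rotationConj (Real.cos α : ℂ) (Real.sin α : ℂ) (monodromy q ℓ z) *ᵥ ![1, m] =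
      ρ • ![1, m] := by
  obtain ⟨ρ, -, hfloquet⟩ := h.exists_isFloquetSolution hq hℓ hper hz
  have hmonodromy := h.toIsSolution.monodromy_mulVec hq hℓ.le
  rw [hfloquet.multiplier, h.init, h.init_deriv] at hmonodromy
  exact ⟨ρ, rotationConj_mulVec (ofReal_cos_sq_add_sin_sq α) hmonodromy⟩

theorem rotationConj_monodromy_apply_ne_zero (hq : ∀ a b, IntervalIntegrable q volume a b)
    (hℓ : 0 ≤ ℓ) (htrace : (monodromy q ℓ lam).trace ^ 2 < 4) (α : ℝ) :
    rotationConj (Real.cos α) (Real.sin α) (monodromy q ℓ lam) 0 1 ≠ 0 := by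
  intro h
  have hdiscrim :=
    trace_sq_sub_four_mul_det (rotationConj (Real.cos α) (Real.sin α) (monodromy q ℓ lam))
  rw [h, mul_zero, zero_mul, sub_zero, trace_rotationConj (Real.cos_sq_add_sin_sq α),
    det_rotationConj (Real.cos_sq_add_sin_sq α), det_monodromy hq hℓ] at hdiscrim
  refine (sq_nonneg _).not_gt (hdiscrim.symm.trans_lt ?_)
  linarith

theorem tendsto_rotationConj_monodromy (hq : ∀ a b, IntervalIntegrable q volume a b) (hℓ : 0 ≤ ℓ)
    (c s lam : ℝ) :
    Tendsto (fun ε : ℝ => rotationConj (c : ℂ) (s : ℂ) (monodromy q ℓ (lam + ε * Complex.I)))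
      (𝓝[>] 0) (𝓝 ((rotationConj c s (monodromy q ℓ lam)).map (↑))) := by
  have hcont : Continuous fun ε : ℝ =>
      rotationConj (c : ℂ) (s : ℂ) (monodromy q ℓ (lam + ε * Complex.I)) := by
    have := continuous_monodromy (𝕜 := ℂ) hq hℓ
    unfold rotationConj
    fun_prop
  have hreal : rotationConj (c : ℂ) (s : ℂ) (monodromy q ℓ (lam : ℂ)) =
      (rotationConj c s (monodromy q ℓ lam)).map (↑) := by
    rw [show monodromy q ℓ (lam : ℂ) = (monodromy q ℓ lam).map Complex.ofRealHom from
      monodromy_algHom hq Complex.ofRealAm hℓ lam]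
    exact rotationConj_map Complex.ofRealHom c s _
  have hlim := (hcont.tendsto 0).mono_left (nhdsWithin_le_nhds (s := Ioi 0))
  rwa [Complex.ofReal_zero, zero_mul, add_zero, hreal] at hlim

theorem isSpectralDensityAt_of_trace_monodromy (hq : ∀ a b, IntervalIntegrable q volume a b)
    (hℓ : 0 < ℓ) (hper : q.Periodic ℓ) (htrace : (monodromy q ℓ lam).trace ^ 2 < 4) (α : ℝ) :
    IsSpectralDensityAt q α lam (√(4 - (monodromy q ℓ lam).trace ^ 2) / (2 * Real.pi *
      |rotationConj (Real.cos α) (Real.sin α) (monodromy q ℓ lam) 0 1|)) := by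
  set N := rotationConj (Real.cos α) (Real.sin α) (monodromy q ℓ lam) with hN
  have hdiscrim := trace_sq_sub_four_mul_det N
  rw [hN, trace_rotationConj (Real.cos_sq_add_sin_sq α),
    det_rotationConj (Real.cos_sq_add_sin_sq α), det_monodromy hq hℓ.le, ← hN] at hdiscrim
  set m : ℝ → ℂ := fun ε => titchmarshWeylM q α (lam + ε * Complex.I)
  set P : ℝ → Matrix (Fin 2) (Fin 2) ℂ := fun ε =>
    rotationConj (Real.cos α : ℂ) (Real.sin α : ℂ) (monodromy q ℓ (lam + ε * Complex.I))
  have hPlim (i j : Fin 2) : Tendsto (fun ε => P ε i j) (𝓝[>] 0) (𝓝 (N i j : ℂ)) := by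
    rw [hN]
    exact ((continuous_id.matrix_elem i j).tendsto _).comp
      (tendsto_rotationConj_monodromy hq hℓ.le (Real.cos α) (Real.sin α) lam)
  have hweyl (ε : ℝ) (hε : 0 < ε) :
      P ε 0 1 * m ε ^ 2 + (P ε 0 0 - P ε 1 1) * m ε + -P ε 1 0 = 0 ∧ 0 ≤ (m ε).im := by
    have him : (lam + ε * Complex.I : ℂ).im = ε := by simp
    have hne : (lam + ε * Complex.I : ℂ).im ≠ 0 := him.trans_ne hε.ne'
    obtain ⟨ψ, dψ, h⟩ := exists_isWeylSolution_titchmarshWeylM hq hℓ hper hne α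
    have hpos : 0 < ε * (m ε).im := by simpa only [him] using h.im_mul_im_pos hq hℓ hper hne
    obtain ⟨ρ, hρ⟩ := h.exists_rotationConj_mulVec_eq_smul hq hℓ hper hne
    exact ⟨quadratic_of_mulVec_eq_smul hρ, (pos_of_mul_pos_right hpos hε.le).le⟩
  have hlim : Tendsto (fun ε => (m ε).im) (𝓝[>] 0)
      (𝓝 (√(4 * N 0 1 * -N 1 0 - (N 0 0 - N 1 1) ^ 2) / (2 * |N 0 1|))) :=
    tendsto_im_of_quadratic (hPlim 0 1) (mod_cast (hPlim 0 0).sub (hPlim 1 1))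
      (mod_cast (hPlim 1 0).neg) (by linarith)
      (eventually_mem_nhdsWithin.mono fun ε hε => (hweyl ε hε).1)
      (eventually_mem_nhdsWithin.mono fun ε hε => (hweyl ε hε).2)
  rw [IsSpectralDensityAt]
  convert hlim.const_mul (1 / Real.pi) using 2
  rw [show 4 * N 0 1 * -N 1 0 - (N 0 0 - N 1 1) ^ 2 = 4 - (monodromy q ℓ lam).trace ^ 2 by
    linarith]
  ring

end SpectralDensity

end Hill

theorem theorem3 (q : ℝ → ℝ) (ℓ : ℝ) (hℓ : 0 < ℓ) (hper : Function.Periodic q ℓ)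
    (hint : IntervalIntegrable q volume 0 ℓ) (α : ℝ) (hα : α ∈ Ico 0 Real.pi) :
    (∀ z : ℂ, z.im ≠ 0 → ∃! m : ℂ, Hill.IsTitchmarshWeyl q α z m) ∧
    ∀ a b : ℝ, Hill.IsStabilityInterval q ℓ a b → ∀ lam ∈ Ioo a b,
      ∀ u du v dv : ℝ → ℝ,
        Hill.IsSolutionIVP q lam 1 0 u du → Hill.IsSolutionIVP q lam 0 1 v dv →
        0 < 4 - (u ℓ + dv ℓ) ^ 2 ∧
        du ℓ * Real.sin α ^ 2 + (u ℓ - dv ℓ) * Real.cos α * Real.sin α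
          - v ℓ * Real.cos α ^ 2 ≠ 0 ∧
        Hill.IsSpectralDensityAt q α lam
          |Real.sqrt (4 - (u ℓ + dv ℓ) ^ 2) /
            (2 * Real.pi * (du ℓ * Real.sin α ^ 2 + (u ℓ - dv ℓ) * Real.cos α * Real.sin α
              - v ℓ * Real.cos α ^ 2))| := by
  have hq : ∀ a b, IntervalIntegrable q volume a b := hper.intervalIntegrable₀ hℓ.ne' hint
  refine ⟨fun z hz => Hill.existsUnique_isTitchmarshWeyl hq hℓ hper hz α, ?_⟩
  intro a b hab lam hlam u du v dv hu hv
  have hmonodromy := Hill.monodromy_eq hq hu hv hℓ.le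
  have htrace := hab.trace_monodromy_sq_lt hq hℓ hlam
  have hcorner := Hill.rotationConj_monodromy_apply_ne_zero hq hℓ.le htrace α
  have hdensity := Hill.isSpectralDensityAt_of_trace_monodromy hq hℓ hper htrace α
  rw [hmonodromy] at htrace
  rw [Hill.rotationConj_apply_zero_one, hmonodromy] at hcorner
  rw [Hill.rotationConj_apply_zero_one, abs_neg, hmonodromy] at hdensity
  simp only [Matrix.trace_fin_two_of, Matrix.of_apply, Matrix.cons_val] at htrace hcorner hdensity
  refine ⟨sub_pos.2 htrace, neg_ne_zero.1 hcorner, ?_⟩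
  rwa [abs_div, abs_mul, abs_of_nonneg (Real.sqrt_nonneg _), abs_of_pos Real.two_pi_pos]
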